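/- **Model.** Fix $N\in\mathbb N$, $Q,\sigma,\delta t,\gamma>0$, a set $\mathcal N\subset\{1,\dots,N-1\}$, and a probability space with a filtration $(\mathcal F_n)_{0\le n\le N}$. Let $((\epsilon_k,\epsilon'_k))_{1\le k\le N}$ be identically distributed, $(\epsilon_k,\epsilon_k')$ being $\mathcal F_k$-measurable and independent of $\mathcal F_{k-1}$, with mean $0$ and covariance matrix $\begin{pmatrix}1&\sqrt3/2\\ \sqrt3/2&1\end{pmatrix}$. Let $V_1,\dots,V_N>0$ be $\mathcal F_0$-measurable and deterministic (almost surely constant). Let $L:\mathbb R\to\mathbb R_+$ be continuous, even, strictly convex, increasing on $\mathbb R_+$, with $L(0)=0$ and $L(\rho)/\rho\to+\infty$ as $\rho\to+\infty$. Let $\ell:\mathbb R\to\mathbb R$ be convex, even, nondecreasing on $\mathbb R_+$, with $\ell(0)=0$. Let $f\in L^1_{loc}(\mathbb R_+)$ be nonnegative and nonincreasing on $(0,\infty)$, and set $G(q)=\int_q^Q f(|Q-y|)\,dy$, $F(q)=\int_q^Q y f(|Q-y|)\,dy$. For $1\le n\le N$, $x,q,S,A\in\mathbb R$ and an adapted real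 process $v$, let for $n\le k\le N$ $$q_k=q-\sum_{j=n}^{k-1}v_j\delta t,\qquad S_k=S+G(q_k)-G(q)+\sigma\sqrt{\delta t}\sum_{j=n}^{k-1}\epsilon_{j+1},\qquad A_k=\frac nkA+\frac1k\sum_{j=n}^{k-1}S_{j+1},$$ $$X_k=x+F(q_k)-F(q)+\sum_{j=n}^{k-1}\Big(v_jS_{j+1}\delta t-q_j\big(G(q_{j+1})-G(q_j)\big)+L\Big(\frac{v_j}{V_{j+1}}\Big)V_{j+1}\delta t-\frac{\sigma v_j\delta t^{3/2}}{\sqrt3}\epsilon'_{j+1}\Big),$$ and $$u_n(x,q,S,A)=\sup_{(v,n^\star)}\mathbb E\Big[-\exp\Big(-\gamma\big(QA_{n^\star}-X_{n^\star}-q_{n^\star}S_{n^\star}-F(0)+F(q_{n^\star})-\ell(q_{n^\star})\big)\Big)\Big]\in[-\infty,0],$$ the supremum being over adapted processes $v$ and stopping times $n^\star$ with values in $(\mathcal N\cup\{N\})\cap\{n,\dots,N\}$ (the expectation being $-\infty$ if the exponential is not integrable). Define $\theta_n(q,Z)\in[-\infty,+\infty]$ for $q,Z\in\mathbb R$ by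 backward induction (with $\log 0=-\infty$, $\log(+\infty)=+\infty$, $\exp(-\infty)=0$, $\exp(+\infty)=+\infty$): $$\theta_n(q,Z)=\begin{cases}\ell(q)+F(0)&\text{if }n=N,\\ \min\{\tilde\theta_{n,n+1}(q,Z),\,\ell(q)+F(0)\}&\text{if }n\in\mathcal N,\\ \tilde\theta_{n,n+1}(q,Z)&\text{otherwise,}\end{cases}$$ where $$\begin{aligned}\tilde\theta_{n,n+1}(q,Z)=\inf_{v\in\mathbb R}\frac1\gamma\log\mathbb E\Big[\exp\Big(\gamma\Big(&\sigma\sqrt{\delta t}\Big(\big(q-\tfrac{Q}{n+1}\big)\epsilon_{n+1}-\tfrac{Q}{n+1}Z\Big)-\frac{\sigma v\,\delta t^{3/2}}{\sqrt3}\epsilon'_{n+1}\\&-\tfrac{Q}{n+1}\big(G(q-v\delta t)-G(q)\big)+L\Big(\frac{v}{V_{n+1}}\Big)V_{n+1}\delta t\\&+\theta_{n+1}\Big(q-v\delta t,\tfrac{n}{n+1}\Big(Z+\epsilon_{n+1}+\frac{G(q-v\delta t)-G(q)}{\sigma\sqrt{\delta t}}\Big)\Big)\Big)\Big)\Big].\end{aligned}$$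 **Proposition.** For all $1\le n\le N$ and all $x,q,S,A\in\mathbb R$, $$u_n(x,q,S,A)=-\exp\Big(-\gamma\Big(QA-x-qS+F(q)-\theta_n\Big(q,\frac{S-A}{\sigma\sqrt{\delta t}}\Big)\Big)\Big)$$ as an identity in $[-\infty,0]$. Moreover $\theta_n>-\infty$ everywhere, and if $\mathbb E[e^{a\epsilon_1+b\epsilon'_1}]<\infty$ for all $a,b\in\mathbb R$, then $\theta_n$ is real-valued. -/

import Mathlib

open MeasureTheory ProbabilityTheory Filter
open scoped ENNReal

/-- Data of the discrete-time accelerated share repurchase model with permanent market impact. -/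
structure ASRModel (Ω : Type*) where
  /-- number of shares to be repurchased -/
  Q : ℝ
  /-- arithmetic volatility -/
  sigma : ℝ
  /-- length of one period -/
  dt : ℝ
  /-- absolute risk aversion -/
  gamma : ℝ
  /-- number of periods -/
  N : ℕ
  /-- indices of the dates before maturity at which delivery is allowed -/
  dates : Set ℕ
  /-- execution cost function `L` -/
  L : ℝ → ℝ
  /-- delivery penalty `ℓ` -/
  pen : ℝ → ℝ
  /-- permanent impact function -/
  f : ℝ → ℝ
  /-- market volume (per unit of time): `V k` is that of the period ending at date `k` -/
  V : ℕ → Ω → ℝ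
  /-- the price noise `ε` -/
  eps : ℕ → Ω → ℝ
  /-- the cash noise `ε′` -/
  epsX : ℕ → Ω → ℝ

namespace ASRModel

variable {Ω : Type*}

/-- `G(q) = ∫_q^Q f(|Q - y|) dy`. -/
noncomputable def G (M : ASRModel Ω) (q : ℝ) : ℝ :=
  ∫ y in q..M.Q, M.f |M.Q - y|

/-- `F(q) = ∫_q^Q y f(|Q - y|) dy`. -/
noncomputable def F (M : ASRModel Ω) (q : ℝ) : ℝ :=
  ∫ y in q..M.Q, y * M.f |M.Q - y|

/-- Standing assumptions of the model on a filtered probability space. -/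
structure Assumptions [MeasurableSpace Ω] (M : ASRModel Ω) (P : Measure Ω)
    (ℱ : Filtration ℕ ‹MeasurableSpace Ω›) : Prop where
  Q_pos : 0 < M.Q
  sigma_pos : 0 < M.sigma
  dt_pos : 0 < M.dt
  gamma_pos : 0 < M.gamma
  dates_subset : ∀ k ∈ M.dates, 1 ≤ k ∧ k < M.N
  -- execution costs
  L_continuous : Continuous M.L
  L_nonneg : ∀ r, 0 ≤ M.L r
  L_zero : M.L 0 = 0
  L_even : ∀ r, M.L (-r) = M.L r
  L_mono : MonotoneOn M.L (Set.Ici 0)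
  L_strictConvex : StrictConvexOn ℝ Set.univ M.L
  L_superlinear : Tendsto (fun r => M.L r / r) atTop atTop
  -- delivery penalty
  pen_convex : ConvexOn ℝ Set.univ M.pen
  pen_even : ∀ q, M.pen (-q) = M.pen q
  pen_mono : MonotoneOn M.pen (Set.Ici 0)
  pen_zero : M.pen 0 = 0
  -- permanent impact: the value `f 0` plays no role, so that `f` may blow up at `0`
  f_nonneg : ∀ y, 0 < y → 0 ≤ M.f y
  f_antitone : AntitoneOn M.f (Set.Ioi 0)
  f_locallyIntegrable : LocallyIntegrableOn M.f (Set.Ici 0)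
  -- market volumes: known at time `0`, positive and deterministic
  V_measurable : ∀ k, 1 ≤ k → k ≤ M.N → Measurable[ℱ 0] (M.V k)
  V_const : ∀ k, 1 ≤ k → k ≤ M.N → ∃ c : ℝ, 0 < c ∧ ∀ᵐ ω ∂P, M.V k ω = c
  -- the innovations: i.i.d. pairs, adapted, and independent of the past
  eps_measurable : ∀ k, 1 ≤ k → k ≤ M.N → Measurable[ℱ k] (M.eps k)
  epsX_measurable : ∀ k, 1 ≤ k → k ≤ M.N → Measurable[ℱ k] (M.epsX k)
  indep_past : ∀ k < M.N,
    Indep (MeasurableSpace.comap (fun ω => (M.eps (k + 1) ω, M.epsX (k + 1) ω)) inferInstance)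
      (ℱ k) P
  identDistrib : ∀ k, 1 ≤ k → k ≤ M.N →
    IdentDistrib (fun ω => (M.eps k ω, M.epsX k ω)) (fun ω => (M.eps 1 ω, M.epsX 1 ω)) P P
  eps_mean : ∀ k, 1 ≤ k → k ≤ M.N → ∫ ω, M.eps k ω ∂P = 0
  epsX_mean : ∀ k, 1 ≤ k → k ≤ M.N → ∫ ω, M.epsX k ω ∂P = 0
  eps_var : ∀ k, 1 ≤ k → k ≤ M.N → variance (M.eps k) P = 1
  epsX_var : ∀ k, 1 ≤ k → k ≤ M.N → variance (M.epsX k) P = 1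
  eps_cov : ∀ k, 1 ≤ k → k ≤ M.N → covariance (M.eps k) (M.epsX k) P = Real.sqrt 3 / 2

/-! State variables at date `k`, started at date `n` and controlled by `v`. -/

/-- Shares remaining to be bought. -/
noncomputable def qAt (M : ASRModel Ω) (n : ℕ) (q : ℝ) (v : ℕ → Ω → ℝ) (k : ℕ) (ω : Ω) : ℝ :=
  q - ∑ j ∈ Finset.Ico n k, v j ω * M.dt

/-- Stock price. -/
noncomputable def SAt (M : ASRModel Ω) (n : ℕ) (q S : ℝ) (v : ℕ → Ω → ℝ) (k : ℕ) (ω : Ω) : ℝ :=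
  S + M.G (M.qAt n q v k ω) - M.G q
    + M.sigma * Real.sqrt M.dt * ∑ j ∈ Finset.Ico n k, M.eps (j + 1) ω

/-- Average price since inception. -/
noncomputable def AAt (M : ASRModel Ω) (n : ℕ) (q S A : ℝ) (v : ℕ → Ω → ℝ) (k : ℕ) (ω : Ω) : ℝ :=
  (n : ℝ) / k * A + 1 / (k : ℝ) * ∑ j ∈ Finset.Ico n k, M.SAt n q S v (j + 1) ω

/-- Cash spent. -/
noncomputable def XAt (M : ASRModel Ω) (n : ℕ) (x q S : ℝ) (v : ℕ → Ω → ℝ) (k : ℕ) (ω : Ω) : ℝ :=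
  x + (M.F (M.qAt n q v k ω) - M.F q)
    + ∑ j ∈ Finset.Ico n k,
        (v j ω * M.SAt n q S v (j + 1) ω * M.dt
          - M.qAt n q v j ω * (M.G (M.qAt n q v (j + 1) ω) - M.G (M.qAt n q v j ω))
          + M.L (v j ω / M.V (j + 1) ω) * M.V (j + 1) ω * M.dt
          - M.sigma * v j ω * M.dt ^ (3 / 2 : ℝ) / Real.sqrt 3 * M.epsX (j + 1) ω)

/-- Final wealth of the bank if it delivers at date `k`. -/
noncomputable def wealth (M : ASRModel Ω) (n : ℕ) (x q S A : ℝ) (v : ℕ → Ω → ℝ) (k : ℕ)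
    (ω : Ω) : ℝ :=
  M.Q * M.AAt n q S A v k ω - M.XAt n x q S v k ω - M.qAt n q v k ω * M.SAt n q S v k ω
    - M.F 0 + M.F (M.qAt n q v k ω) - M.pen (M.qAt n q v k ω)

/-- Admissible strategies from date `n` on: an adapted process `v` (only its values before the
delivery date matter) and a stopping time with values in the delivery dates not before `n`. -/
def strategies [MeasurableSpace Ω] (M : ASRModel Ω) (ℱ : Filtration ℕ ‹MeasurableSpace Ω›)
    (n : ℕ) : Set ((ℕ → Ω → ℝ) × (Ω → ℕ)) :=
  {s | (∀ k, Measurable[ℱ k] (s.1 k)) ∧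
    IsStoppingTime ℱ (fun ω => ((s.2 ω : ℕ) : WithTop ℕ)) ∧
    ∀ ω, (s.2 ω ∈ M.dates ∨ s.2 ω = M.N) ∧ n ≤ s.2 ω ∧ s.2 ω ≤ M.N}

/-- The value function at date `n`, in the extended reals: a strategy whose exponential disutility
is not integrable has expected utility `-∞`. -/
noncomputable def u [MeasurableSpace Ω] (M : ASRModel Ω) (P : Measure Ω)
    (ℱ : Filtration ℕ ‹MeasurableSpace Ω›) (n : ℕ) (x q S A : ℝ) : EReal :=
  ⨆ s ∈ M.strategies ℱ n,
    -((∫⁻ ω, ENNReal.ofReal (Real.exp (-M.gamma * M.wealth n x q S A s.1 (s.2 ω) ω)) ∂P : ℝ≥0∞)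
      : EReal)

/-- The one-step operator: `θ̃_{n,n+1}(q, Z)`, with `next` in the place of `θ_{n+1}`. -/
noncomputable def thetaTilde [MeasurableSpace Ω] (M : ASRModel Ω) (P : Measure Ω) (n : ℕ)
    (next : ℝ → ℝ → EReal) (q Z : ℝ) : EReal :=
  ⨅ v : ℝ, ((1 / M.gamma : ℝ) : EReal) * ENNReal.log (∫⁻ ω, EReal.exp ((M.gamma : EReal) *
    (((M.sigma * Real.sqrt M.dt *
          ((q - M.Q / (n + 1)) * M.eps (n + 1) ω - M.Q / (n + 1) * Z)
        - M.sigma * v * M.dt ^ (3 / 2 : ℝ) / Real.sqrt 3 * M.epsX (n + 1) ω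
        - M.Q / (n + 1) * (M.G (q - v * M.dt) - M.G q)
        + M.L (v / M.V (n + 1) ω) * M.V (n + 1) ω * M.dt : ℝ) : EReal)
      + next (q - v * M.dt)
          ((n : ℝ) / (n + 1) * (Z + M.eps (n + 1) ω
            + (M.G (q - v * M.dt) - M.G q) / (M.sigma * Real.sqrt M.dt))))) ∂P)

open scoped Classical in
/-- `θ_n`, defined by backward induction from `n = N`. -/
noncomputable def theta [MeasurableSpace Ω] (M : ASRModel Ω) (P : Measure Ω) (n : ℕ) :
    ℝ → ℝ → EReal :=
  if n < M.N then
    if n ∈ M.dates then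
      fun q Z => min (M.thetaTilde P n (theta M P (n + 1)) q Z) ((M.pen q + M.F 0 : ℝ) : EReal)
    else fun q Z => M.thetaTilde P n (theta M P (n + 1)) q Z
  else fun q _ => ((M.pen q + M.F 0 : ℝ) : EReal)
termination_by M.N - n

end ASRModel

/-! Let `B_k = Q A_k - X_k - q_k S_k + F(q_k)` be the book value and `Z_k = (S_k - A_k)/(σ√δt)`. In
`B_{k+1} - B_k` the cash paid for shares, the impact on the stock still to be bought and the
increments of `F` all cancel. What remains depends only on the control, the new noises, the volume
and `(q_k, Z_k)`, and `(q, Z)` is itself driven by the control and the noises (`bookValue_succ`,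
`redState_succ`). Hence the disutility of a strategy factors through the reduced state.

Consider the potential `exp(-γ B_k) · exp(γ θ_k(q_k, Z_k))`. Noises independent of the past and the
recursion for `exp(γθ)` make it a submartingale under every strategy up to the delivery date. There
it is at most the realised disutility, since `θ ≤ ℓ + F(0)` at delivery dates. This bounds the cost
of every strategy from below (`le_cost`). All integrands take values in `[0, ∞]`, so no
integrability is needed.

The bound is attained (`exists_cost_eq`) by a feedback strategy that minimises each one-step problem
and delivers as soon as `θ = ℓ + F(0)` at an allowed date. This needs measurable minimisers. By
backward induction, `exp(γθ_n)` is lower semicontinuous and at least `exp(-C(1+|q|+|Z|))`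
(`isRegular_expTheta`). Given this at date `n+1`, Fatou makes the one-step cost lower
semicontinuous. The superlinear `L` beats all other terms, which grow at most linearly for bounded
noise, so the cost is coercive in `v` (`exists_stepCost_lower`). Coercivity and semicontinuity give
a measurable smallest minimiser, and the lower bound persists.

The lower bound also gives `θ_n > -∞`. Under exponential moments, the choice `v = 0` bounds `θ_n`
from above. -/

open scoped Topology

/-! ### Measurable minimisers of coercive lower semicontinuous functions -/

section Semicontinuity

theorem LowerSemicontinuous.ennreal_continuous_mul {X : Type*} [TopologicalSpace X]
    {a W : X → ℝ≥0∞} (ha : Continuous a) (ha0 : ∀ x, a x ≠ 0) (haT : ∀ x, a x ≠ ∞)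
    (hW : LowerSemicontinuous W) : LowerSemicontinuous fun x => a x * W x := by
  intro x y hy
  have h1 : y / a x < W x := ENNReal.div_lt_of_lt_mul' hy
  obtain ⟨m, hm1, hm2⟩ := exists_between h1
  have h2 : y < a x * m := by
    rwa [ENNReal.div_lt_iff (Or.inl (ha0 x)) (Or.inl (haT x)), mul_comm] at hm1
  have h3 : Tendsto (fun x' => a x' * m) (𝓝 x) (𝓝 (a x * m)) :=
    ENNReal.Tendsto.mul_const ha.continuousAt (Or.inl (ha0 x))
  filter_upwards [h3.eventually (lt_mem_nhds h2), hW x m hm2] with x' h4 h5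
  exact h4.trans_le (by gcongr)

/-- Fatou's lemma, which applies along neighbourhood filters because these are countably generated.
-/
theorem lowerSemicontinuous_lintegral {X α : Type*} [TopologicalSpace X]
    [FirstCountableTopology X] [MeasurableSpace α] {μ : Measure α} {g : X → α → ℝ≥0∞}
    (hm : ∀ x, Measurable (g x)) (hg : ∀ a, LowerSemicontinuous fun x => g x a) :
    LowerSemicontinuous fun x => ∫⁻ a, g x a ∂μ := by
  rw [lowerSemicontinuous_iff_le_liminf]
  intro x
  refine le_trans (lintegral_mono fun a => ?_) (lintegral_liminf_le hm)
  exact (lowerSemicontinuous_iff_le_liminf.1 (hg a)) x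

/-- Uniformly for `y` near any point, `g v y` is as large as one likes for `|v|` large. -/
def LocallyCoercive {E : Type*} [TopologicalSpace E] (g : ℝ → E → ℝ≥0∞) : Prop :=
  ∀ y₀ : E, ∀ K : ℝ≥0∞, K < ∞ → ∃ R : ℝ, ∀ᶠ y in 𝓝 y₀, ∀ v : ℝ, R < |v| → K ≤ g v y

variable {E : Type*} [TopologicalSpace E] {g : ℝ → E → ℝ≥0∞}

/-- Coercivity controls large `|v|` uniformly near `y₀`, and compactness of the remaining part of
`C` makes the semicontinuity bound uniform there. General closed `C` is needed for the half-lines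
`(-∞, c]` in the measurability of the smallest minimiser. -/
theorem LocallyCoercive.lowerSemicontinuous_biInf (hc : LocallyCoercive g)
    (hg : LowerSemicontinuous fun p : ℝ × E => g p.1 p.2) {C : Set ℝ} (hC : IsClosed C) :
    LowerSemicontinuous fun y => ⨅ v ∈ C, g v y := by
  intro y₀ K hK
  obtain ⟨K', hK1, hK2⟩ := exists_between hK
  obtain ⟨R, hR⟩ := hc y₀ K' (hK2.trans_le le_top)
  have hcomp : IsCompact (C ∩ Set.Icc (-R) R) := isCompact_Icc.inter_left hC
  have h1 : ∀ᶠ y in 𝓝 y₀, ∀ v ∈ C ∩ Set.Icc (-R) R, K' < g v y := by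
    refine hcomp.eventually_forall_of_forall_eventually fun v hv => ?_
    have h2 : K' < g v y₀ := hK2.trans_le (iInf₂_le v hv.1)
    have h3 := hg (v, y₀) K' h2
    exact (continuous_swap.tendsto (y₀, v)).eventually h3
  filter_upwards [hR, h1] with y h2 h3
  refine hK1.trans_le (le_iInf₂ fun v hv => ?_)
  by_cases hvR : R < |v|
  · exact h2 v hvR
  · exact (h3 v ⟨hv, abs_le.1 (not_lt.1 hvR)⟩).le

theorem LocallyCoercive.lowerSemicontinuous_iInf (hc : LocallyCoercive g)
    (hg : LowerSemicontinuous fun p : ℝ × E => g p.1 p.2) :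
    LowerSemicontinuous fun y => ⨅ v, g v y := by
  simpa using hc.lowerSemicontinuous_biInf hg isClosed_univ

theorem LocallyCoercive.exists_biInf_eq (hc : LocallyCoercive g)
    (hg : LowerSemicontinuous fun p : ℝ × E => g p.1 p.2) {C : Set ℝ} (hC : IsClosed C) {y : E}
    (hy : ⨅ v ∈ C, g v y ≠ ∞) : ∃ v ∈ C, g v y = ⨅ v ∈ C, g v y := by
  obtain ⟨K', hK1, hK2⟩ := exists_between (lt_top_iff_ne_top.2 hy)
  obtain ⟨R, hR⟩ := hc y K' hK2
  have hR := hR.self_of_nhds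
  obtain ⟨v₁, hv₁⟩ := iInf_lt_iff.1 hK1
  obtain ⟨hv₁C, hv₁K⟩ := iInf_lt_iff.1 hv₁
  have hbd : ∀ v, g v y < K' → v ∈ Set.Icc (-R) R := fun v hv =>
    abs_le.1 (not_lt.1 fun h => (hR v h).not_gt hv)
  have hcomp : IsCompact (C ∩ Set.Icc (-R) R) := isCompact_Icc.inter_left hC
  have hgy : LowerSemicontinuous fun v => g v y :=
    hg.comp (by fun_prop : Continuous fun v : ℝ => (v, y))
  have hne : (C ∩ Set.Icc (-R) R).Nonempty := ⟨v₁, hv₁C, hbd v₁ hv₁K⟩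
  obtain ⟨v₀, hv₀, hmin⟩ := (hgy.lowerSemicontinuousOn (C ∩ Set.Icc (-R) R)).exists_isMinOn
    hne hcomp
  refine ⟨v₀, hv₀.1, le_antisymm (le_iInf₂ fun v hv => ?_) (iInf₂_le v₀ hv₀.1)⟩
  by_cases h : g v y < K'
  · exact isMinOn_iff.1 hmin v ⟨hv, hbd v h⟩
  · exact (isMinOn_iff.1 hmin v₁ ⟨hv₁C, hbd v₁ hv₁K⟩).trans
      (hv₁K.le.trans (not_lt.1 h))

open scoped Classical in
/-- The smallest minimiser of a coercive lower semicontinuous function depends measurably on the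
parameter. -/
theorem LocallyCoercive.exists_measurable_argmin [MeasurableSpace E] [BorelSpace E]
    (hc : LocallyCoercive g) (hg : LowerSemicontinuous fun p : ℝ × E => g p.1 p.2) :
    ∃ w : E → ℝ, Measurable w ∧ ∀ y, g (w y) y = ⨅ v, g v y := by
  let m : E → ℝ≥0∞ := fun y => ⨅ v, g v y
  have hm : Measurable m := (hc.lowerSemicontinuous_iInf hg).measurable
  let A : E → Set ℝ := fun y => {v | g v y ≤ m y}
  have hA : ∀ y, m y ≠ ∞ → (A y).Nonempty ∧ IsClosed (A y) ∧ BddBelow (A y) := by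
    intro y hy
    refine ⟨?_, ?_, ?_⟩
    · obtain ⟨v, -, hv⟩ := hc.exists_biInf_eq hg isClosed_univ (y := y)
        (by simpa only [Set.mem_univ, iInf_pos] using hy)
      exact ⟨v, by simpa [A, m] using hv.le⟩
    · exact (hg.comp (by fun_prop : Continuous fun v : ℝ => (v, y))).isClosed_preimage (m y)
    · obtain ⟨K', hK1, hK2⟩ := exists_between (lt_top_iff_ne_top.2 hy)
      obtain ⟨R, hR⟩ := hc y K' hK2
      refine ⟨-R, fun v hv => ?_⟩
      by_contra h
      have : R < |v| := by
        rw [lt_abs]; right; linarith [not_le.1 h]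
      exact absurd (hR.self_of_nhds v this) (not_le.2 (lt_of_le_of_lt hv hK1))
  refine ⟨fun y => if m y = ∞ then 0 else sInf (A y), ?_, fun y => ?_⟩
  · refine measurable_of_Iic fun c => ?_
    -- The smallest minimiser is at most `c` exactly when the minimum over `(-∞, c]` does not exceed
    -- the global one, and both minima are measurable in `y`. Where the minimum is `∞` every `v` is
    -- a minimiser and the default is `0`.
    have : (fun y => if m y = ∞ then 0 else sInf (A y)) ⁻¹' Set.Iic c =
        ({y | m y = ∞} ∩ {_y | 0 ≤ c}) ∪ ({y | m y = ∞}ᶜ ∩ {y | ⨅ v ∈ Set.Iic c, g v y ≤ m y}) := by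
      ext y
      by_cases hy : m y = ∞
      · simp [hy]
      · simp only [Set.mem_preimage, hy, if_false, Set.mem_Iic, Set.mem_union, Set.mem_inter_iff,
          Set.mem_ofPred_eq, false_and, Set.mem_compl_iff, not_false_eq_true, true_and, false_or]
        obtain ⟨h1, h2, h3⟩ := hA y hy
        constructor
        · intro h
          exact (iInf₂_le (sInf (A y)) h).trans (h2.csInf_mem h1 h3)
        · intro h
          obtain ⟨v, hv, hv2⟩ := hc.exists_biInf_eq hg (isClosed_Iic (a := c)) (y := y)
            (ne_top_of_le_ne_top hy h)
          exact (csInf_le h3 (show g v y ≤ m y from hv2.trans_le h)).trans hv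
    rw [this]
    have hmt : MeasurableSet {y | m y = ∞} := hm (measurableSet_singleton _)
    refine (hmt.inter (MeasurableSet.const _)).union (hmt.compl.inter ?_)
    exact measurableSet_le (hc.lowerSemicontinuous_biInf hg isClosed_Iic).measurable hm
  · by_cases hy : m y = ∞
    · have h0 : ∀ v, g v y = ∞ := iInf_eq_top.1 hy
      simp [h0]
    · simp only [hy, if_false]
      obtain ⟨h1, h2, h3⟩ := hA y hy
      exact le_antisymm (h2.csInf_mem h1 h3) (iInf_le _ _)

end Semicontinuity

/-! ### Continuity and growth of the impact, penalty and cost functions -/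

namespace ASRModel

variable {Ω : Type*} [MeasurableSpace Ω] {M : ASRModel Ω} {P : Measure Ω}
  {ℱ : Filtration ℕ ‹MeasurableSpace Ω›}

theorem Assumptions.intervalIntegrable_f_abs (hM : M.Assumptions P ℱ) (a b : ℝ) :
    IntervalIntegrable (fun t => M.f |t|) volume a b := by
  have hpos : ∀ c : ℝ, 0 ≤ c → IntervalIntegrable (fun t => M.f |t|) volume 0 c := by
    intro c hc
    have h1 : IntegrableOn M.f (Set.Icc 0 c) :=
      hM.f_locallyIntegrable.integrableOn_compact_subset Set.Icc_subset_Ici_self isCompact_Icc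
    have h2 : IntervalIntegrable M.f volume 0 c :=
      (intervalIntegrable_iff_integrableOn_Icc_of_le hc).2 h1
    refine h2.congr ?_
    intro t ht
    rw [Set.uIoc_of_le hc] at ht
    simp [abs_of_pos ht.1]
  have h0 : ∀ c : ℝ, IntervalIntegrable (fun t => M.f |t|) volume 0 c := by
    intro c
    rcases le_total 0 c with hc | hc
    · exact hpos c hc
    · have := (hpos (-c) (by linarith)).comp_sub_left 0
      simpa using this
  exact (h0 a).symm.trans (h0 b)

theorem Assumptions.intervalIntegrable_f (hM : M.Assumptions P ℱ) (a b : ℝ) :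
    IntervalIntegrable (fun y => M.f |M.Q - y|) volume a b := by
  have := (hM.intervalIntegrable_f_abs (M.Q - a) (M.Q - b)).comp_sub_left M.Q
  simpa using this

theorem Assumptions.continuous_G (hM : M.Assumptions P ℱ) : Continuous M.G := by
  have h := intervalIntegral.continuous_primitive (μ := volume) hM.intervalIntegrable_f M.Q
  have : M.G = fun q => -∫ y in M.Q..q, M.f |M.Q - y| := by
    funext q; rw [G, intervalIntegral.integral_symm]
  rw [this]; exact h.neg

theorem Assumptions.continuous_F (hM : M.Assumptions P ℱ) : Continuous M.F := by
  have h := intervalIntegral.continuous_primitive (μ := volume)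
    (f := fun y => y * M.f |M.Q - y|)
    (fun a b => (hM.intervalIntegrable_f a b).continuousOn_mul continuousOn_id) M.Q
  have : M.F = fun q => -∫ y in M.Q..q, y * M.f |M.Q - y| := by
    funext q; rw [F, intervalIntegral.integral_symm]
  rw [this]; exact h.neg

theorem Assumptions.continuous_pen (hM : M.Assumptions P ℱ) : Continuous M.pen :=
  continuousOn_univ.1 (hM.pen_convex.continuousOn isOpen_univ)

theorem Assumptions.pen_nonneg (hM : M.Assumptions P ℱ) (q : ℝ) : 0 ≤ M.pen q := by
  have h : ∀ q, 0 ≤ q → 0 ≤ M.pen q := fun q hq => by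
    have := hM.pen_mono (Set.mem_Ici.2 le_rfl) (Set.mem_Ici.2 hq) hq
    rwa [hM.pen_zero] at this
  rcases le_total 0 q with hq | hq
  · exact h q hq
  · rw [← hM.pen_even]; exact h _ (by linarith)

/-- After the shift `t = Q - q`, `G` is the odd primitive of `f(|t|)`. The possible singularity at
`0` contributes a finite constant, and beyond `1` the monotone `f` is at most `f 1`. -/
theorem Assumptions.abs_G_le (hM : M.Assumptions P ℱ) :
    ∃ C : ℝ, 0 ≤ C ∧ ∀ q, |M.G q| ≤ C * (1 + |q|) := by
  let H : ℝ → ℝ := fun t => ∫ s in (0 : ℝ)..t, M.f |s|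
  have hG : ∀ q, M.G q = H (M.Q - q) := by
    intro q
    have := intervalIntegral.integral_comp_sub_left (fun t => M.f |t|) M.Q (a := q) (b := M.Q)
    simpa [G, H] using this
  have hf0 : ∀ᵐ s : ℝ, 0 ≤ M.f |s| := by
    have : ∀ᵐ s : ℝ, s ≠ 0 := by simp [ae_iff]
    filter_upwards [this] with s hs using hM.f_nonneg _ (abs_pos.2 hs)
  have hHnn : ∀ t, 0 ≤ t → 0 ≤ H t := fun t ht =>
    intervalIntegral.integral_nonneg_of_ae ht hf0
  have hf1 : 0 ≤ M.f 1 := hM.f_nonneg 1 one_pos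
  have hHle : ∀ t, 0 ≤ t → H t ≤ H 1 + M.f 1 * t := by
    intro t ht
    rcases le_total t 1 with h1 | h1
    · have : H 1 = H t + ∫ s in t..1, M.f |s| :=
        (intervalIntegral.integral_add_adjacent_intervals (hM.intervalIntegrable_f_abs _ _)
          (hM.intervalIntegrable_f_abs _ _)).symm
      have h2 : 0 ≤ ∫ s in t..1, M.f |s| := intervalIntegral.integral_nonneg_of_ae h1 hf0
      nlinarith [mul_nonneg hf1 ht]
    · have : H t = H 1 + ∫ s in (1 : ℝ)..t, M.f |s| :=
        (intervalIntegral.integral_add_adjacent_intervals (hM.intervalIntegrable_f_abs _ _)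
          (hM.intervalIntegrable_f_abs _ _)).symm
      have h2 : ∫ s in (1 : ℝ)..t, M.f |s| ≤ ∫ _s in (1 : ℝ)..t, M.f 1 := by
        refine intervalIntegral.integral_mono_on h1 (hM.intervalIntegrable_f_abs _ _)
          intervalIntegrable_const fun s hs => ?_
        rw [abs_of_nonneg (zero_le_one.trans hs.1)]
        exact hM.f_antitone (Set.mem_Ioi.2 one_pos) (Set.mem_Ioi.2 (one_pos.trans_le hs.1)) hs.1
      rw [intervalIntegral.integral_const, smul_eq_mul] at h2
      nlinarith
  have hHodd : ∀ t, H (-t) = -H t := by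
    intro t
    have := intervalIntegral.integral_comp_neg (fun s => M.f |s|) (a := 0) (b := t)
    simp only [abs_neg, neg_zero] at this
    simp only [H]
    rw [intervalIntegral.integral_symm, ← this]
  have hH : ∀ t, |H t| ≤ H 1 + M.f 1 * |t| := by
    intro t
    rcases le_total 0 t with ht | ht
    · rw [abs_of_nonneg (hHnn t ht), abs_of_nonneg ht]; exact hHle t ht
    · have h := hHodd t
      have ht' : 0 ≤ -t := by linarith
      have h1 := hHnn (-t) ht'
      have h2 := hHle (-t) ht'
      rw [h] at h1 h2
      rw [abs_of_nonpos (by linarith), abs_of_nonpos ht]; linarith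
  have hH1 := hHnn 1 zero_le_one
  refine ⟨H 1 + M.f 1 * (M.Q + 1), by have := hM.Q_pos; positivity, fun q => ?_⟩
  rw [hG]
  have h1 := hH (M.Q - q)
  have h2 : |M.Q - q| ≤ M.Q + |q| := (abs_sub _ _).trans (by rw [abs_of_pos hM.Q_pos])
  have hq := abs_nonneg q
  have hQ := hM.Q_pos
  have h3 : M.f 1 * |M.Q - q| ≤ M.f 1 * (M.Q + |q|) := by gcongr
  nlinarith [mul_nonneg hH1 hq, mul_nonneg (mul_nonneg hf1 hQ.le) hq]

theorem Assumptions.L_ge (hM : M.Assumptions P ℱ) (K : ℝ) :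
    ∃ C : ℝ, ∀ r, K * |r| - C ≤ M.L r := by
  obtain ⟨R, hR⟩ := eventually_atTop.1 (hM.L_superlinear.eventually_ge_atTop K)
  have key : ∀ r, 0 ≤ r → K * r - |K| * (|R| + 1) ≤ M.L r := by
    intro r hr
    by_cases h : |R| + 1 ≤ r
    · have hr0 : 0 < r := lt_of_lt_of_le (by positivity) h
      have := hR r (by linarith [le_abs_self R])
      rw [le_div_iff₀ hr0] at this
      have h0 : 0 ≤ |K| * (|R| + 1) := by positivity
      linarith
    · have h1 : K * r ≤ |K| * r := by gcongr; exact le_abs_self K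
      have h2 : |K| * r ≤ |K| * (|R| + 1) := by gcongr; exact (not_le.1 h).le
      have := hM.L_nonneg r
      linarith
  refine ⟨|K| * (|R| + 1), fun r => ?_⟩
  rcases le_total 0 r with hr | hr
  · rw [abs_of_nonneg hr]; exact key r hr
  · rw [abs_of_nonpos hr, ← hM.L_even]; exact key _ (by linarith)


/-! ### The one-step cost: semicontinuity and coercivity -/

variable {Ω : Type*} [MeasurableSpace Ω] {M : ASRModel Ω} {P : Measure Ω}
  {ℱ : Filtration ℕ ‹MeasurableSpace Ω›}

/-- The exponent (without `γ` and without `θ`) in the one-step operator, when the market volume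
is the constant `c`. -/
noncomputable def stepExponent (M : ASRModel Ω) (k : ℕ) (c v : ℝ) (y e : ℝ × ℝ) : ℝ :=
  M.sigma * Real.sqrt M.dt * ((y.1 - M.Q / (k + 1)) * e.1 - M.Q / (k + 1) * y.2)
    - M.sigma * v * M.dt ^ (3 / 2 : ℝ) / Real.sqrt 3 * e.2
    - M.Q / (k + 1) * (M.G (y.1 - v * M.dt) - M.G y.1)
    + M.L (v / c) * c * M.dt

/-- The reduced state `(q, Z)` at date `k + 1`. -/
noncomputable def stepState (M : ASRModel Ω) (k : ℕ) (v : ℝ) (y e : ℝ × ℝ) : ℝ × ℝ :=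
  (y.1 - v * M.dt, (k : ℝ) / (k + 1) * (y.2 + e.1
    + (M.G (y.1 - v * M.dt) - M.G y.1) / (M.sigma * Real.sqrt M.dt)))

/-- The multiplicative one-step cost. -/
noncomputable def stepFactor (M : ASRModel Ω) (k : ℕ) (c : ℝ) (W : ℝ × ℝ → ℝ≥0∞) (v : ℝ)
    (y e : ℝ × ℝ) : ℝ≥0∞ :=
  ENNReal.ofReal (Real.exp (M.gamma * M.stepExponent k c v y e)) * W (M.stepState k v y e)

/-- The expected multiplicative one-step cost of the control `v`. -/
noncomputable def stepCost (M : ASRModel Ω) (k : ℕ) (c : ℝ) (μ : Measure (ℝ × ℝ))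
    (W : ℝ × ℝ → ℝ≥0∞) (v : ℝ) (y : ℝ × ℝ) : ℝ≥0∞ :=
  ∫⁻ e, M.stepFactor k c W v y e ∂μ

/-- The joint law of the two noises at date `k`. -/
noncomputable def noiseLaw (M : ASRModel Ω) (P : Measure Ω) (k : ℕ) : Measure (ℝ × ℝ) :=
  P.map fun ω => (M.eps k ω, M.epsX k ω)

/-- `exp (γ θ_n)`. -/
noncomputable def expTheta (M : ASRModel Ω) (P : Measure Ω) (n : ℕ) (y : ℝ × ℝ) : ℝ≥0∞ :=
  EReal.exp ((M.gamma : EReal) * M.theta P n y.1 y.2)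

theorem Assumptions.continuous_stepExponent (hM : M.Assumptions P ℱ) (k : ℕ) (c : ℝ) :
    Continuous fun p : ℝ × (ℝ × ℝ) × (ℝ × ℝ) => M.stepExponent k c p.1 p.2.1 p.2.2 := by
  have := hM.continuous_G
  have := hM.L_continuous
  unfold stepExponent
  fun_prop

theorem Assumptions.continuous_stepState (hM : M.Assumptions P ℱ) (k : ℕ) :
    Continuous fun p : ℝ × (ℝ × ℝ) × (ℝ × ℝ) => M.stepState k p.1 p.2.1 p.2.2 := by
  have := hM.continuous_G
  unfold stepState
  fun_prop

theorem Assumptions.measurable_stepFactor (hM : M.Assumptions P ℱ) (k : ℕ) (c : ℝ)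
    {W : ℝ × ℝ → ℝ≥0∞} (hW : Measurable W) :
    Measurable fun p : ℝ × (ℝ × ℝ) × (ℝ × ℝ) => M.stepFactor k c W p.1 p.2.1 p.2.2 := by
  have h1 := (hM.continuous_stepExponent k c).measurable
  have h2 := (hM.continuous_stepState k).measurable
  exact ((h1.const_mul M.gamma).exp.ennreal_ofReal).mul (hW.comp h2)

theorem Assumptions.measurable_stepFactor_right (hM : M.Assumptions P ℱ) (k : ℕ) (c : ℝ)
    {W : ℝ × ℝ → ℝ≥0∞} (hW : Measurable W) (v : ℝ) (y : ℝ × ℝ) :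
    Measurable fun e => M.stepFactor k c W v y e := by
  have h : Measurable fun e : ℝ × ℝ => ((v, y, e) : ℝ × (ℝ × ℝ) × (ℝ × ℝ)) :=
    measurable_const.prodMk (measurable_const.prodMk measurable_id)
  simpa only [Function.comp_def] using Measurable.comp (hM.measurable_stepFactor k c hW) h

theorem Assumptions.lowerSemicontinuous_stepCost (hM : M.Assumptions P ℱ) (k : ℕ) (c : ℝ)
    (μ : Measure (ℝ × ℝ)) {W : ℝ × ℝ → ℝ≥0∞} (hW : LowerSemicontinuous W) :
    LowerSemicontinuous fun p : ℝ × (ℝ × ℝ) => M.stepCost k c μ W p.1 p.2 := by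
  refine lowerSemicontinuous_lintegral (fun p => ?_) fun e => ?_
  · exact hM.measurable_stepFactor_right k c hW.measurable p.1 p.2
  · have hc : Continuous fun p : ℝ × (ℝ × ℝ) => (p.1, p.2, e) := by fun_prop
    refine LowerSemicontinuous.ennreal_continuous_mul ?_ (fun p => ?_) (fun p => ?_)
      (hW.comp ((hM.continuous_stepState k).comp hc))
    · exact ENNReal.continuous_ofReal.comp (Real.continuous_exp.comp
        (continuous_const.mul ((hM.continuous_stepExponent k c).comp hc)))
    · simp [Real.exp_pos]
    · exact ENNReal.ofReal_ne_top

/-- Lower semicontinuity together with an at most exponentially small lower bound. -/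
structure IsRegular (W : ℝ × ℝ → ℝ≥0∞) : Prop where
  lowerSemicontinuous : LowerSemicontinuous W
  exists_lower : ∃ C : ℝ, 0 ≤ C ∧
    ∀ y : ℝ × ℝ, ENNReal.ofReal (Real.exp (-C * (1 + |y.1| + |y.2|))) ≤ W y

open Asymptotics in
-- The products `q ε` and `v ε'` are the only obstacles to linear growth, so the noise is confined
-- to a ball. The execution cost is removed because it is the superlinear term.
theorem Assumptions.exists_linear_bound (hM : M.Assumptions P ℱ) (k : ℕ) (c R : ℝ) :
    ∃ D : ℝ, 0 ≤ D ∧ ∀ (v : ℝ) (y e : ℝ × ℝ), ‖e‖ ≤ R →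
      |M.stepExponent k c v y e - M.L (v / c) * c * M.dt| ≤ D * (1 + |y.1| + |y.2| + |v|) ∧
      1 + |(M.stepState k v y e).1| + |(M.stepState k v y e).2|
        ≤ D * (1 + |y.1| + |y.2| + |v|) := by
  -- Big-O along a principal filter is a bound with a single constant on the whole set.
  let l : Filter (ℝ × (ℝ × ℝ) × (ℝ × ℝ)) := 𝓟 {p | ‖p.2.2‖ ≤ R}
  let T : ℝ × (ℝ × ℝ) × (ℝ × ℝ) → ℝ := fun p => 1 + |p.2.1.1| + |p.2.1.2| + |p.1|
  have hT : ∀ p, ‖T p‖ = 1 + |p.2.1.1| + |p.2.1.2| + |p.1| := fun p =>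
    abs_of_nonneg (by positivity)
  have le_T : ∀ {φ : ℝ × (ℝ × ℝ) × (ℝ × ℝ) → ℝ}, (∀ p, |φ p| ≤ T p) → φ =O[l] T := fun h =>
    IsBigO.of_bound' (Eventually.of_forall fun p => (h p).trans (le_abs_self _))
  have h1 : (fun _ => (1 : ℝ)) =O[l] T := le_T fun p => by
    simp only [T, abs_one]; linarith [abs_nonneg p.2.1.1, abs_nonneg p.2.1.2, abs_nonneg p.1]
  have hq : (fun p => p.2.1.1) =O[l] T := le_T fun p => by
    simp only [T]; linarith [abs_nonneg p.2.1.1, abs_nonneg p.2.1.2, abs_nonneg p.1]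
  have hZ : (fun p => p.2.1.2) =O[l] T := le_T fun p => by
    simp only [T]; linarith [abs_nonneg p.2.1.1, abs_nonneg p.2.1.2, abs_nonneg p.1]
  have hv : (fun p => p.1) =O[l] T := le_T fun p => by
    simp only [T]; linarith [abs_nonneg p.2.1.1, abs_nonneg p.2.1.2, abs_nonneg p.1]
  have he1 : (fun p => p.2.2.1) =O[l] (fun _ => (1 : ℝ)) :=
    isBigO_principal.2 ⟨R, fun p hp => by
      simpa using (norm_fst_le p.2.2).trans hp⟩
  have he2 : (fun p => p.2.2.2) =O[l] (fun _ => (1 : ℝ)) :=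
    isBigO_principal.2 ⟨R, fun p hp => by
      simpa using (norm_snd_le p.2.2).trans hp⟩
  have hconst : ∀ a : ℝ, (fun _ => a) =O[l] T := fun a =>
    (isBigO_const_const a one_ne_zero l).trans h1
  obtain ⟨Γ, hΓ0, hΓ⟩ := hM.abs_G_le
  have hG : ∀ {φ : ℝ × (ℝ × ℝ) × (ℝ × ℝ) → ℝ}, φ =O[l] T → (fun p => M.G (φ p)) =O[l] T := by
    intro φ hφ
    have : (fun p => M.G (φ p)) =O[l] fun p => 1 + |φ p| :=
      IsBigO.of_bound Γ (Eventually.of_forall fun p => (hΓ _).trans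
        (mul_le_mul_of_nonneg_left (le_abs_self _) hΓ0))
    exact this.trans (h1.add hφ.norm_left)
  have hq' : (fun p => p.2.1.1 - p.1 * M.dt) =O[l] T :=
    hq.sub ((hv.const_mul_left M.dt).congr_left fun p => mul_comm _ _)
  have hGd : (fun p => M.G (p.2.1.1 - p.1 * M.dt) - M.G p.2.1.1) =O[l] T := (hG hq').sub (hG hq)
  have mulT : ∀ {φ ψ : ℝ × (ℝ × ℝ) × (ℝ × ℝ) → ℝ}, φ =O[l] T → ψ =O[l] (fun _ => (1 : ℝ)) →
      (fun p => φ p * ψ p) =O[l] T := fun h h' => by simpa using h.mul h'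
  have hX : (fun p => M.stepExponent k c p.1 p.2.1 p.2.2 - M.L (p.1 / c) * c * M.dt) =O[l] T := by
    have := (((((mulT (hq.sub (hconst (M.Q / (k + 1)))) he1).sub
      (hZ.const_mul_left (M.Q / (k + 1)))).const_mul_left (M.sigma * Real.sqrt M.dt)).sub
      (mulT (hv.const_mul_left (M.sigma * M.dt ^ (3 / 2 : ℝ) / Real.sqrt 3)) he2)).sub
      (hGd.const_mul_left (M.Q / (k + 1))))
    refine this.congr_left fun p => ?_
    simp only [stepExponent]; ring
  have hY : (fun p => 1 + |(M.stepState k p.1 p.2.1 p.2.2).1| + |(M.stepState k p.1 p.2.1 p.2.2).2|)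
      =O[l] T := by
    have hZ' : (fun p => (M.stepState k p.1 p.2.1 p.2.2).2) =O[l] T := ?_
    · exact (h1.add hq'.norm_left).add hZ'.norm_left
    refine IsBigO.const_mul_left ((hZ.add (he1.trans h1)).add ?_) _
    refine (hGd.const_mul_left (M.sigma * Real.sqrt M.dt)⁻¹).congr_left fun p => ?_
    rw [div_eq_inv_mul]
  obtain ⟨D1, hD1⟩ := isBigO_principal.1 hX
  obtain ⟨D2, hD2⟩ := isBigO_principal.1 hY
  refine ⟨max (max D1 D2) 0, le_max_right _ _, fun v y e he => ⟨?_, ?_⟩⟩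
  · refine (hD1 (v, y, e) he).trans ?_
    rw [hT]
    exact mul_le_mul_of_nonneg_right ((le_max_left _ _).trans (le_max_left _ _)) (by positivity)
  · refine (le_abs_self _).trans ((hD2 (v, y, e) he).trans ?_)
    rw [hT]
    exact mul_le_mul_of_nonneg_right ((le_max_right _ _).trans (le_max_left _ _)) (by positivity)

/-- The integral is restricted to a ball of noises of positive probability, on which everything
except the execution cost is linearly bounded. -/
theorem Assumptions.exists_stepCost_lower (hM : M.Assumptions P ℱ) (k : ℕ) {c : ℝ} (hc : 0 < c)
    (μ : Measure (ℝ × ℝ)) [IsProbabilityMeasure μ] {W : ℝ × ℝ → ℝ≥0∞} (hW : IsRegular W) :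
    ∃ C : ℝ, 0 ≤ C ∧ ∀ (v : ℝ) (y : ℝ × ℝ),
      ENNReal.ofReal (Real.exp (|v| - C * (1 + |y.1| + |y.2|))) ≤ M.stepCost k c μ W v y := by
  obtain ⟨R, hR⟩ : ∃ R : ℕ, μ (Metric.closedBall 0 R) ≠ 0 := by
    by_contra! h
    have h2 : μ (⋃ R : ℕ, Metric.closedBall (0 : ℝ × ℝ) R) = 0 := measure_iUnion_null h
    rw [Metric.iUnion_closedBall_nat, measure_univ] at h2
    exact one_ne_zero h2
  obtain ⟨C, hC0, hC⟩ := hW.exists_lower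
  obtain ⟨D, hD0, hD⟩ := hM.exists_linear_bound k c R
  have hγ := hM.gamma_pos
  have hdt := hM.dt_pos
  -- After multiplication by `γ c δt` this slope yields `γD + CD + 1` times `|v|`: the first two
  -- terms pay for the exponent and for the lower bound on `W`, the last leaves the `|v|` of the
  -- claim.
  obtain ⟨E, hE⟩ := hM.L_ge ((M.gamma * D + C * D + 1) / (M.gamma * M.dt))
  set p := (μ (Metric.closedBall 0 R)).toReal with hp
  have hp0 : 0 < p := ENNReal.toReal_pos hR (measure_ne_top _ _)
  refine ⟨M.gamma * D + C * D + |M.gamma * c * M.dt * E| + |Real.log p|, by positivity,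
    fun v y => ?_⟩
  let X : ℝ := |v| - (M.gamma * D + C * D + |M.gamma * c * M.dt * E|) * (1 + |y.1| + |y.2|)
  have hX : ∀ e ∈ Metric.closedBall (0 : ℝ × ℝ) R,
      ENNReal.ofReal (Real.exp X) ≤ M.stepFactor k c W v y e := by
    intro e he
    rw [mem_closedBall_zero_iff] at he
    obtain ⟨h1, h2⟩ := hD v y e he
    refine le_trans ?_ (mul_le_mul' le_rfl (hC _))
    rw [← ENNReal.ofReal_mul (Real.exp_nonneg _), ← Real.exp_add]
    refine ENNReal.ofReal_le_ofReal (Real.exp_le_exp.2 ?_)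
    have h3 : (M.gamma * D + C * D + 1) * |v| - M.gamma * c * M.dt * E
        ≤ M.gamma * (M.L (v / c) * c * M.dt) := by
      have h4 := mul_le_mul_of_nonneg_left (hE (v / c))
        (by positivity : 0 ≤ M.gamma * c * M.dt)
      rw [abs_div, abs_of_pos hc] at h4
      have h5 : M.gamma * c * M.dt * ((M.gamma * D + C * D + 1) / (M.gamma * M.dt) * (|v| / c) - E)
        = (M.gamma * D + C * D + 1) * |v| - M.gamma * c * M.dt * E := by
        field_simp
      rw [h5] at h4
      linarith
    have h4 := mul_le_mul_of_nonneg_left (abs_le.1 h1).1 hγ.le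
    have h5 := mul_le_mul_of_nonneg_left h2 hC0
    have h6 : M.gamma * c * M.dt * E ≤ |M.gamma * c * M.dt * E| * (1 + |y.1| + |y.2|) := by
      refine (le_abs_self _).trans (le_mul_of_one_le_right (abs_nonneg _) ?_)
      linarith [abs_nonneg y.1, abs_nonneg y.2]
    simp only [X]
    nlinarith
  calc ENNReal.ofReal (Real.exp (|v| - (M.gamma * D + C * D + |M.gamma * c * M.dt * E|
          + |Real.log p|) * (1 + |y.1| + |y.2|)))
      ≤ ENNReal.ofReal (Real.exp (X + Real.log p)) := by
        refine ENNReal.ofReal_le_ofReal (Real.exp_le_exp.2 ?_)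
        have : -Real.log p ≤ |Real.log p| * (1 + |y.1| + |y.2|) := by
          refine (neg_le_abs _).trans (le_mul_of_one_le_right (abs_nonneg _) ?_)
          linarith [abs_nonneg y.1, abs_nonneg y.2]
        simp only [X]
        linarith
    _ = ENNReal.ofReal (Real.exp X) * μ (Metric.closedBall 0 R) := by
        rw [Real.exp_add, Real.exp_log hp0, ENNReal.ofReal_mul (Real.exp_nonneg _), hp,
          ENNReal.ofReal_toReal (measure_ne_top _ _)]
    _ = ∫⁻ _ in Metric.closedBall 0 (R : ℝ), ENNReal.ofReal (Real.exp X) ∂μ := by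
        rw [setLIntegral_const]
    _ ≤ ∫⁻ e in Metric.closedBall 0 (R : ℝ), M.stepFactor k c W v y e ∂μ :=
        setLIntegral_mono' Metric.isClosed_closedBall.measurableSet hX
    _ ≤ M.stepCost k c μ W v y := setLIntegral_le_lintegral _ _

theorem Assumptions.locallyCoercive_stepCost (hM : M.Assumptions P ℱ) (k : ℕ) {c : ℝ}
    (hc : 0 < c) (μ : Measure (ℝ × ℝ)) [IsProbabilityMeasure μ] {W : ℝ × ℝ → ℝ≥0∞}
    (hW : IsRegular W) : LocallyCoercive (M.stepCost k c μ W) := by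
  obtain ⟨C, hC0, hC⟩ := hM.exists_stepCost_lower k hc μ hW
  intro y₀ K hK
  have hcont : Continuous fun y : ℝ × ℝ => C * (1 + |y.1| + |y.2|) := by fun_prop
  refine ⟨K.toReal + (C * (1 + |y₀.1| + |y₀.2|) + 1), ?_⟩
  filter_upwards [hcont.continuousAt.eventually (gt_mem_nhds (lt_add_one _))] with y hy v hv
  refine le_trans ?_ (hC v y)
  rw [← ENNReal.ofReal_toReal hK.ne]
  refine ENNReal.ofReal_le_ofReal ?_
  have := Real.add_one_le_exp (|v| - C * (1 + |y.1| + |y.2|))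
  linarith

/-- The same `C` serves for all `v`, as `|v| ≥ 0` can be dropped from the bound. -/
theorem Assumptions.isRegular_iInf_stepCost (hM : M.Assumptions P ℱ) (k : ℕ) {c : ℝ}
    (hc : 0 < c) (μ : Measure (ℝ × ℝ)) [IsProbabilityMeasure μ] {W : ℝ × ℝ → ℝ≥0∞}
    (hW : IsRegular W) : IsRegular fun y => ⨅ v, M.stepCost k c μ W v y := by
  refine ⟨(hM.locallyCoercive_stepCost k hc μ hW).lowerSemicontinuous_iInf
    (hM.lowerSemicontinuous_stepCost k c μ hW.lowerSemicontinuous), ?_⟩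
  obtain ⟨C, hC0, hC⟩ := hM.exists_stepCost_lower k hc μ hW
  refine ⟨C, hC0, fun y => le_iInf fun v => le_trans ?_ (hC v y)⟩
  refine ENNReal.ofReal_le_ofReal (Real.exp_le_exp.2 ?_)
  linarith [abs_nonneg v]

/-! ### The recursion for `exp (γ θ)` and its regularity -/

/-- `x ↦ exp (γ x)` is an order isomorphism from the extended reals onto `[0, ∞]`, so it commutes
with infima even at infinite values. -/
theorem exp_gamma_mul_iInf {γ : ℝ} (hγ : 0 < γ) {ι : Sort*} (I : ι → ℝ≥0∞) :
    EReal.exp ((γ : EReal) * ⨅ i, ((1 / γ : ℝ) : EReal) * ENNReal.log (I i)) = ⨅ i, I i := by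
  have h : ∀ x : EReal, EReal.exp ((γ : EReal) * x)
      = (EReal.expOrderIso.trans (ENNReal.orderIsoRpow γ hγ)) x := fun x => by
    rw [mul_comm, EReal.exp_mul]; rfl
  rw [h, OrderIso.map_iInf]
  refine iInf_congr fun i => ?_
  rw [← h, ← mul_assoc, ← EReal.coe_mul, mul_one_div_cancel hγ.ne', EReal.coe_one, one_mul,
    ENNReal.exp_log]

theorem exp_gamma_mul_coe_add {γ : ℝ} (hγ : 0 < γ) (r : ℝ) (x : EReal) :
    EReal.exp ((γ : EReal) * ((r : EReal) + x))
      = ENNReal.ofReal (Real.exp (γ * r)) * EReal.exp ((γ : EReal) * x) := by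
  rw [mul_comm, EReal.exp_mul, EReal.exp_add, ENNReal.mul_rpow_of_nonneg _ _ hγ.le,
    ← EReal.exp_mul, ← EReal.exp_mul, mul_comm, mul_comm x, mul_comm (r : EReal),
    ← EReal.coe_mul, EReal.exp_coe, mul_comm]

theorem Assumptions.measurable_noise (hM : M.Assumptions P ℱ) {k : ℕ} (h1 : 1 ≤ k)
    (hk : k ≤ M.N) : Measurable fun ω => (M.eps k ω, M.epsX k ω) :=
  ((hM.eps_measurable k h1 hk).mono (ℱ.le k) le_rfl).prodMk
    ((hM.epsX_measurable k h1 hk).mono (ℱ.le k) le_rfl)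

/-- Since the volume is almost surely constant, the expectation becomes an integral against the law
of the noise alone. -/
theorem Assumptions.exp_thetaTilde (hM : M.Assumptions P ℱ) {n : ℕ} (hn : n < M.N) {c : ℝ}
    (hV : ∀ᵐ ω ∂P, M.V (n + 1) ω = c)
    {next : ℝ → ℝ → EReal}
    (hW : Measurable fun y : ℝ × ℝ => EReal.exp ((M.gamma : EReal) * next y.1 y.2)) (y : ℝ × ℝ) :
    EReal.exp ((M.gamma : EReal) * M.thetaTilde P n next y.1 y.2)
      = ⨅ v, M.stepCost n c (M.noiseLaw P (n + 1))
          (fun y => EReal.exp ((M.gamma : EReal) * next y.1 y.2)) v y := by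
  rw [thetaTilde, exp_gamma_mul_iInf hM.gamma_pos]
  refine iInf_congr fun v => ?_
  rw [stepCost, noiseLaw, lintegral_map _ (hM.measurable_noise (by lia) hn)]
  · refine lintegral_congr_ae ?_
    filter_upwards [hV] with ω hω
    rw [exp_gamma_mul_coe_add hM.gamma_pos, hω]
    rfl
  · exact hM.measurable_stepFactor_right n c hW v y

theorem expTheta_terminal {n : ℕ} (hn : M.N ≤ n) (y : ℝ × ℝ) :
    M.expTheta P n y = ENNReal.ofReal (Real.exp (M.gamma * (M.pen y.1 + M.F 0))) := by
  rw [expTheta, theta, if_neg (not_lt.2 hn), ← EReal.coe_mul, EReal.exp_coe]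

theorem Assumptions.expTheta_of_notMem (hM : M.Assumptions P ℱ) {n : ℕ} (hn : n < M.N) {c : ℝ}
    (hV : ∀ᵐ ω ∂P, M.V (n + 1) ω = c) (hd : n ∉ M.dates)
    (hW : Measurable (M.expTheta P (n + 1))) (y : ℝ × ℝ) :
    M.expTheta P n y
      = ⨅ v, M.stepCost n c (M.noiseLaw P (n + 1)) (M.expTheta P (n + 1)) v y := by
  rw [expTheta, theta, if_pos hn, if_neg hd]
  exact hM.exp_thetaTilde hn hV hW y

theorem Assumptions.expTheta_of_mem (hM : M.Assumptions P ℱ) {n : ℕ} (hn : n < M.N) {c : ℝ}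
    (hV : ∀ᵐ ω ∂P, M.V (n + 1) ω = c) (hd : n ∈ M.dates)
    (hW : Measurable (M.expTheta P (n + 1))) (y : ℝ × ℝ) :
    M.expTheta P n y
      = min (⨅ v, M.stepCost n c (M.noiseLaw P (n + 1)) (M.expTheta P (n + 1)) v y)
          (ENNReal.ofReal (Real.exp (M.gamma * (M.pen y.1 + M.F 0)))) := by
  rw [expTheta, theta, if_pos hn, if_pos hd]
  have hmono : Monotone fun x : EReal => EReal.exp ((M.gamma : EReal) * x) := fun a b hab =>
    EReal.exp_monotone (mul_le_mul_of_nonneg_left hab (EReal.coe_nonneg.2 hM.gamma_pos.le))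
  refine (hmono.map_min).trans ?_
  refine congrArg₂ min (hM.exp_thetaTilde hn hV hW y) ?_
  rw [← EReal.coe_mul, EReal.exp_coe]

theorem Assumptions.isProbabilityMeasure_noiseLaw [IsProbabilityMeasure P]
    (hM : M.Assumptions P ℱ) {k : ℕ} (h1 : 1 ≤ k) (hk : k ≤ M.N) :
    IsProbabilityMeasure (M.noiseLaw P k) :=
  Measure.isProbabilityMeasure_map (hM.measurable_noise h1 hk).aemeasurable

theorem Assumptions.isRegular_penalty (hM : M.Assumptions P ℱ) :
    IsRegular fun y => ENNReal.ofReal (Real.exp (M.gamma * (M.pen y.1 + M.F 0))) := by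
  have := hM.continuous_pen
  refine ⟨(ENNReal.continuous_ofReal.comp
    (by fun_prop : Continuous fun y : ℝ × ℝ =>
      Real.exp (M.gamma * (M.pen y.1 + M.F 0)))).lowerSemicontinuous, M.gamma * |M.F 0|,
    mul_nonneg hM.gamma_pos.le (abs_nonneg _), fun y => ?_⟩
  refine ENNReal.ofReal_le_ofReal (Real.exp_le_exp.2 ?_)
  rw [neg_mul, mul_assoc, ← mul_neg]
  refine mul_le_mul_of_nonneg_left ?_ hM.gamma_pos.le
  have h1 : |M.F 0| ≤ |M.F 0| * (1 + |y.1| + |y.2|) :=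
    le_mul_of_one_le_right (abs_nonneg _) (by linarith [abs_nonneg y.1, abs_nonneg y.2])
  linarith [hM.pen_nonneg y.1, neg_abs_le (M.F 0)]

theorem IsRegular.min {W W' : ℝ × ℝ → ℝ≥0∞} (h : IsRegular W) (h' : IsRegular W') :
    IsRegular fun y => min (W y) (W' y) := by
  refine ⟨h.lowerSemicontinuous.inf h'.lowerSemicontinuous, ?_⟩
  obtain ⟨C, hC0, hC⟩ := h.exists_lower
  obtain ⟨C', hC0', hC'⟩ := h'.exists_lower
  have key : ∀ {a b t : ℝ}, a ≤ b → 0 ≤ t →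
      ENNReal.ofReal (Real.exp (-b * t)) ≤ ENNReal.ofReal (Real.exp (-a * t)) := fun hab ht =>
    ENNReal.ofReal_le_ofReal (Real.exp_le_exp.2
      (mul_le_mul_of_nonneg_right (neg_le_neg hab) ht))
  refine ⟨max C C', hC0.trans (le_max_left _ _), fun y => le_min ?_ ?_⟩
  · exact (key (le_max_left _ _) (by positivity)).trans (hC y)
  · exact (key (le_max_right _ _) (by positivity)).trans (hC' y)

theorem Assumptions.isRegular_expTheta [IsProbabilityMeasure P] (hM : M.Assumptions P ℱ) (n : ℕ) :
    IsRegular (M.expTheta P n) := by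
  by_cases hn : n < M.N
  · have ih := hM.isRegular_expTheta (n + 1)
    have hW := ih.lowerSemicontinuous.measurable
    obtain ⟨c, hc, hV⟩ := hM.V_const (n + 1) (by lia) hn
    have := hM.isProbabilityMeasure_noiseLaw (k := n + 1) (by lia) hn
    have h1 := hM.isRegular_iInf_stepCost n hc (M.noiseLaw P (n + 1)) ih
    by_cases hd : n ∈ M.dates
    · rw [funext (hM.expTheta_of_mem hn hV hd hW)]
      exact h1.min hM.isRegular_penalty
    · rw [funext (hM.expTheta_of_notMem hn hV hd hW)]
      exact h1
  · rw [funext (expTheta_terminal (not_lt.1 hn))]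
    exact hM.isRegular_penalty
termination_by M.N - n

theorem Assumptions.theta_ne_bot [IsProbabilityMeasure P] (hM : M.Assumptions P ℱ) (n : ℕ)
    (q Z : ℝ) : M.theta P n q Z ≠ ⊥ := by
  intro h
  obtain ⟨C, -, hC⟩ := (hM.isRegular_expTheta n).exists_lower
  have h2 := hC (q, Z)
  rw [expTheta, h, EReal.coe_mul_bot_of_pos hM.gamma_pos, EReal.exp_bot] at h2
  rw [nonpos_iff_eq_zero, ENNReal.ofReal_eq_zero] at h2
  exact absurd h2 (not_le.2 (Real.exp_pos _))


/-! ### Finiteness under exponential moments -/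

section Finite

variable {Ω : Type*} [MeasurableSpace Ω] {M : ASRModel Ω} {P : Measure Ω}
  {ℱ : Filtration ℕ ‹MeasurableSpace Ω›}

theorem Assumptions.expTheta_le_iInf_stepCost [IsProbabilityMeasure P] (hM : M.Assumptions P ℱ)
    {n : ℕ} (hn : n < M.N) {c : ℝ} (hV : ∀ᵐ ω ∂P, M.V (n + 1) ω = c) (y : ℝ × ℝ) :
    M.expTheta P n y
      ≤ ⨅ v, M.stepCost n c (M.noiseLaw P (n + 1)) (M.expTheta P (n + 1)) v y := by
  have hW := (hM.isRegular_expTheta (n + 1)).lowerSemicontinuous.measurable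
  by_cases hd : n ∈ M.dates
  · rw [hM.expTheta_of_mem hn hV hd hW]
    exact min_le_left _ _
  · rw [hM.expTheta_of_notMem hn hV hd hW]

theorem Assumptions.expTheta_le_penalty [IsProbabilityMeasure P] (hM : M.Assumptions P ℱ)
    {n : ℕ} (hn : n ∈ M.dates ∨ n = M.N) (y : ℝ × ℝ) :
    M.expTheta P n y ≤ ENNReal.ofReal (Real.exp (M.gamma * (M.pen y.1 + M.F 0))) := by
  rcases hn with hd | rfl
  · have hn := (hM.dates_subset n hd).2
    obtain ⟨c, -, hV⟩ := hM.V_const (n + 1) (by lia) hn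
    rw [hM.expTheta_of_mem hn hV hd
      (hM.isRegular_expTheta (n + 1)).lowerSemicontinuous.measurable]
    exact min_le_right _ _
  · rw [expTheta_terminal le_rfl]

/-- With exponential moments, not trading before maturity gives a bound on `θ_n` which is affine
in `Z`. -/
theorem Assumptions.exists_expTheta_upper [IsProbabilityMeasure P] (hM : M.Assumptions P ℱ)
    (hexp : ∀ a b : ℝ, Integrable (fun ω => Real.exp (a * M.eps 1 ω + b * M.epsX 1 ω)) P)
    (n : ℕ) : ∃ (φ : ℝ → ℝ) (d : ℝ), ∀ y : ℝ × ℝ,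
      M.expTheta P n y ≤ ENNReal.ofReal (Real.exp (φ y.1 + d * y.2)) := by
  by_cases hn : n < M.N
  · obtain ⟨φ, d, hφ⟩ := hM.exists_expTheta_upper hexp (n + 1)
    obtain ⟨c, hc, hV⟩ := hM.V_const (n + 1) (by lia) hn
    let s : ℝ := M.sigma * Real.sqrt M.dt
    let b : ℝ := M.Q / (n + 1)
    let r : ℝ := (n : ℝ) / (n + 1)
    -- The total coefficient of `ε` when `v = 0`: one part from the exponent, one from the new `Z`
    -- through the inductive bound.
    let α : ℝ → ℝ := fun q => M.gamma * s * (q - b) + d * r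
    let J : ℝ → ℝ≥0∞ := fun q => ∫⁻ ω, ENNReal.ofReal (Real.exp (α q * M.eps 1 ω)) ∂P
    have hJ : ∀ q, J q ≠ ∞ := fun q => by
      have h := (hexp (α q) 0).lintegral_lt_top
      simp only [zero_mul, add_zero] at h
      exact h.ne
    -- The moment `J` is moved into the exponent by `J ≤ exp J`.
    refine ⟨fun q => φ q + (J q).toReal, d * r - M.gamma * s * b, fun y => ?_⟩
    refine (hM.expTheta_le_iInf_stepCost hn hV y).trans ((iInf_le _ 0).trans ?_)
    have hlaw : M.noiseLaw P (n + 1) = M.noiseLaw P 1 :=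
      (hM.identDistrib (n + 1) (by lia) hn).map_eq
    have hstep : ∀ e, M.stepFactor n c (M.expTheta P (n + 1)) 0 y e ≤
        ENNReal.ofReal (Real.exp (φ y.1 + (d * r - M.gamma * s * b) * y.2))
          * ENNReal.ofReal (Real.exp (α y.1 * e.1)) := by
      intro e
      refine (mul_le_mul' le_rfl (hφ _)).trans (le_of_eq ?_)
      rw [← ENNReal.ofReal_mul (Real.exp_nonneg _), ← ENNReal.ofReal_mul (Real.exp_nonneg _),
        ← Real.exp_add, ← Real.exp_add]
      congr 2
      simp only [stepExponent, stepState, α, s, b, r, zero_mul, sub_zero, sub_self, zero_div,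
        mul_zero, hM.L_zero, add_zero]
      ring
    calc M.stepCost n c (M.noiseLaw P (n + 1)) (M.expTheta P (n + 1)) 0 y
        ≤ ∫⁻ e, ENNReal.ofReal (Real.exp (φ y.1 + (d * r - M.gamma * s * b) * y.2))
          * ENNReal.ofReal (Real.exp (α y.1 * e.1)) ∂(M.noiseLaw P 1) := by
          rw [stepCost, hlaw]; exact lintegral_mono hstep
      _ = ENNReal.ofReal (Real.exp (φ y.1 + (d * r - M.gamma * s * b) * y.2)) * J y.1 := by
          rw [lintegral_const_mul' _ _ ENNReal.ofReal_ne_top, noiseLaw,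
            lintegral_map (by fun_prop) (hM.measurable_noise le_rfl (by lia))]
      _ ≤ ENNReal.ofReal (Real.exp (φ y.1 + (d * r - M.gamma * s * b) * y.2))
          * ENNReal.ofReal (Real.exp (J y.1).toReal) := by
          gcongr
          rw [← ENNReal.ofReal_toReal (hJ y.1)]
          refine ENNReal.ofReal_le_ofReal ?_
          rw [ENNReal.ofReal_toReal (hJ y.1)]
          linarith [Real.add_one_le_exp (J y.1).toReal]
      _ = _ := by
          rw [← ENNReal.ofReal_mul (Real.exp_nonneg _), ← Real.exp_add]
          congr 2; ring
  · refine ⟨fun q => M.gamma * (M.pen q + M.F 0), 0, fun y => ?_⟩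
    rw [expTheta_terminal (not_lt.1 hn), zero_mul, add_zero]
termination_by M.N - n

theorem Assumptions.theta_ne_top [IsProbabilityMeasure P] (hM : M.Assumptions P ℱ)
    (hexp : ∀ a b : ℝ, Integrable (fun ω => Real.exp (a * M.eps 1 ω + b * M.epsX 1 ω)) P)
    (n : ℕ) (q Z : ℝ) : M.theta P n q Z ≠ ⊤ := by
  intro h
  obtain ⟨φ, d, hφ⟩ := hM.exists_expTheta_upper hexp n
  have h2 := hφ (q, Z)
  rw [expTheta, h, EReal.coe_mul_top_of_pos hM.gamma_pos, EReal.exp_top, top_le_iff] at h2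
  exact ENNReal.ofReal_ne_top h2

end Finite

/-! ### Dynamics of the book value and the reduced state -/

section Dynamics

variable {Ω : Type*} (M : ASRModel Ω)

/-- The value of the bank's position at date `k`, before penalties. -/
noncomputable def bookValue (n : ℕ) (x q S A : ℝ) (v : ℕ → Ω → ℝ) (k : ℕ) (ω : Ω) : ℝ :=
  M.Q * M.AAt n q S A v k ω - M.XAt n x q S v k ω - M.qAt n q v k ω * M.SAt n q S v k ω
    + M.F (M.qAt n q v k ω)

/-- The reduced state `(q, Z)` along a strategy. -/
noncomputable def redState (n : ℕ) (q S A : ℝ) (v : ℕ → Ω → ℝ) (k : ℕ) (ω : Ω) : ℝ × ℝ :=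
  (M.qAt n q v k ω,
    (M.SAt n q S v k ω - M.AAt n q S A v k ω) / (M.sigma * Real.sqrt M.dt))

/-- Disutility of the book value at date `k`. -/
noncomputable def weight (n : ℕ) (x q S A : ℝ) (v : ℕ → Ω → ℝ) (k : ℕ)
    (ω : Ω) : ℝ≥0∞ :=
  ENNReal.ofReal (Real.exp (-M.gamma * M.bookValue n x q S A v k ω))

variable {M} {n k : ℕ} {x q S A : ℝ} {v : ℕ → Ω → ℝ} {ω : Ω}

theorem wealth_eq_bookValue : M.wealth n x q S A v k ω
    = M.bookValue n x q S A v k ω - (M.pen (M.redState n q S A v k ω).1 + M.F 0) := by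
  simp only [wealth, bookValue, redState]; ring

theorem exp_wealth_eq :
    ENNReal.ofReal (Real.exp (-M.gamma * M.wealth n x q S A v k ω))
      = M.weight n x q S A v k ω * ENNReal.ofReal
        (Real.exp (M.gamma * (M.pen (M.redState n q S A v k ω).1 + M.F 0))) := by
  rw [weight, ← ENNReal.ofReal_mul (Real.exp_nonneg _), ← Real.exp_add, wealth_eq_bookValue]
  congr 2; ring

theorem qAt_self : M.qAt n q v n ω = q := by simp [qAt]

theorem SAt_self : M.SAt n q S v n ω = S := by simp [SAt, qAt_self]

theorem AAt_self (hn : n ≠ 0) : M.AAt n q S A v n ω = A := by simp [AAt, hn]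

theorem XAt_self : M.XAt n x q S v n ω = x := by simp [XAt, qAt_self]

theorem bookValue_self (hn : n ≠ 0) :
    M.bookValue n x q S A v n ω = M.Q * A - x - q * S + M.F q := by
  rw [bookValue, qAt_self, SAt_self, AAt_self hn, XAt_self]

theorem redState_self (hn : n ≠ 0) :
    M.redState n q S A v n ω = (q, (S - A) / (M.sigma * Real.sqrt M.dt)) := by
  rw [redState, qAt_self, SAt_self, AAt_self hn]

theorem qAt_succ (hk : n ≤ k) :
    M.qAt n q v (k + 1) ω = M.qAt n q v k ω - v k ω * M.dt := by
  simp only [qAt, Finset.sum_Ico_succ_top hk]; ring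

theorem SAt_succ (hk : n ≤ k) : M.SAt n q S v (k + 1) ω = M.SAt n q S v k ω
    + (M.G (M.qAt n q v (k + 1) ω) - M.G (M.qAt n q v k ω))
    + M.sigma * Real.sqrt M.dt * M.eps (k + 1) ω := by
  simp only [SAt, Finset.sum_Ico_succ_top hk]; ring

theorem AAt_succ (hn : n ≠ 0) (hk : n ≤ k) : M.AAt n q S A v (k + 1) ω
    = (k : ℝ) / (k + 1) * M.AAt n q S A v k ω + 1 / ((k : ℝ) + 1) * M.SAt n q S v (k + 1) ω := by
  have h0 : (k : ℝ) ≠ 0 := Nat.cast_ne_zero.2 (by lia)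
  have h1 : (k : ℝ) + 1 ≠ 0 := by positivity
  simp only [AAt, Finset.sum_Ico_succ_top hk]
  push_cast
  field_simp
  ring

theorem XAt_succ (hk : n ≤ k) : M.XAt n x q S v (k + 1) ω = M.XAt n x q S v k ω
    + (M.F (M.qAt n q v (k + 1) ω) - M.F (M.qAt n q v k ω))
    + (v k ω * M.SAt n q S v (k + 1) ω * M.dt
      - M.qAt n q v k ω * (M.G (M.qAt n q v (k + 1) ω) - M.G (M.qAt n q v k ω))
      + M.L (v k ω / M.V (k + 1) ω) * M.V (k + 1) ω * M.dt
      - M.sigma * v k ω * M.dt ^ (3 / 2 : ℝ) / Real.sqrt 3 * M.epsX (k + 1) ω) := by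
  simp only [XAt, Finset.sum_Ico_succ_top hk]; ring

/-- The averaging recursion gives `S_{k+1} - A_{k+1} = k/(k+1) · (S_{k+1} - A_k)`. -/
theorem redState_succ (hs : M.sigma * Real.sqrt M.dt ≠ 0) (hn : n ≠ 0) (hk : n ≤ k) :
    M.redState n q S A v (k + 1) ω = M.stepState k (v k ω) (M.redState n q S A v k ω)
      (M.eps (k + 1) ω, M.epsX (k + 1) ω) := by
  have h1 : (k : ℝ) + 1 ≠ 0 := by positivity
  refine Prod.ext (qAt_succ hk) ?_
  simp only [redState, stepState]
  rw [AAt_succ hn hk, SAt_succ hk, qAt_succ hk]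
  generalize M.sigma * Real.sqrt M.dt = s at *
  field_simp
  ring

/-- The payment `v S_{k+1} δt` cancels against the change in `q S`, as does `q` times the increment
of `G`; the increments of `F` cancel with those in the cash account. Only the averaging term, the
noises and the execution cost survive. -/
theorem bookValue_succ (hs : M.sigma * Real.sqrt M.dt ≠ 0) (hn : n ≠ 0) (hk : n ≤ k) :
    M.bookValue n x q S A v (k + 1) ω = M.bookValue n x q S A v k ω
      - M.stepExponent k (M.V (k + 1) ω) (v k ω) (M.redState n q S A v k ω)
        (M.eps (k + 1) ω, M.epsX (k + 1) ω) := by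
  have h1 : (k : ℝ) + 1 ≠ 0 := by positivity
  simp only [bookValue, redState, stepExponent]
  rw [AAt_succ hn hk, XAt_succ hk, SAt_succ hk, qAt_succ hk]
  generalize M.sigma * Real.sqrt M.dt = s at *
  generalize M.L (v k ω / M.V (k + 1) ω) * M.V (k + 1) ω * M.dt = l at *
  generalize M.dt ^ (3 / 2 : ℝ) = t at *
  field_simp
  ring

section Measurability

variable {m : MeasurableSpace Ω}

theorem measurable_qAt (hv : ∀ j < k, Measurable (v j)) : Measurable (M.qAt n q v k) := by
  refine measurable_const.sub (Finset.measurable_fun_sum _ fun j hj => ?_)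
  exact (hv j (Finset.mem_Ico.1 hj).2).mul_const _

theorem measurable_SAt (hG : Measurable M.G) (hv : ∀ j < k, Measurable (v j))
    (he : ∀ j < k, Measurable (M.eps (j + 1))) : Measurable (M.SAt n q S v k) := by
  refine ((measurable_const.add (hG.comp (measurable_qAt hv))).sub_const _).add
    ((Finset.measurable_fun_sum _ fun j hj => ?_).const_mul _)
  exact he j (Finset.mem_Ico.1 hj).2

theorem measurable_AAt (hG : Measurable M.G) (hv : ∀ j < k, Measurable (v j))
    (he : ∀ j < k, Measurable (M.eps (j + 1))) : Measurable (M.AAt n q S A v k) := by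
  refine measurable_const.add ((Finset.measurable_fun_sum _ fun j hj => ?_).const_mul _)
  have := (Finset.mem_Ico.1 hj).2
  exact measurable_SAt hG (fun i hi => hv i (by lia)) (fun i hi => he i (by lia))

theorem measurable_redState (hG : Measurable M.G) (hv : ∀ j < k, Measurable (v j))
    (he : ∀ j < k, Measurable (M.eps (j + 1))) : Measurable (M.redState n q S A v k) :=
  (measurable_qAt hv).prodMk
    (((measurable_SAt hG hv he).sub (measurable_AAt hG hv he)).div_const _)

theorem measurable_bookValue (hG : Measurable M.G) (hF : Measurable M.F) (hL : Measurable M.L)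
    (hv : ∀ j < k, Measurable (v j)) (he : ∀ j < k, Measurable (M.eps (j + 1)))
    (he' : ∀ j < k, Measurable (M.epsX (j + 1))) (hV : ∀ j < k, Measurable (M.V (j + 1))) :
    Measurable (M.bookValue n x q S A v k) := by
  have hq := measurable_qAt (M := M) (n := n) (q := q) hv
  have hS := measurable_SAt (n := n) (q := q) (S := S) hG hv he
  have hX : Measurable (M.XAt n x q S v k) := by
    refine (measurable_const.add ((hF.comp hq).sub_const _)).add
      (Finset.measurable_fun_sum _ fun j hj => ?_)
    have hj := (Finset.mem_Ico.1 hj).2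
    have h1 := hv j hj
    have h2 := hV j hj
    have h3 := he' j hj
    have h4 : Measurable (M.SAt n q S v (j + 1)) :=
      measurable_SAt hG (fun i hi => hv i (by lia)) (fun i hi => he i (by lia))
    have h5 : Measurable (M.qAt n q v (j + 1)) := measurable_qAt (fun i hi => hv i (by lia))
    have h6 : Measurable (M.qAt n q v j) := measurable_qAt (fun i hi => hv i (by lia))
    fun_prop
  have hA := measurable_AAt (n := n) (q := q) (S := S) (A := A) hG hv he
  exact (((hA.const_mul _).sub hX).sub (hq.mul hS)).add (hF.comp hq)

end Measurability

end Dynamics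

end ASRModel

/-! ### Verification: the potential along a strategy -/

/-- Freezing: by independence the joint law is a product, and Tonelli applies. -/
theorem lintegral_comp_of_indep {Ω α β : Type*} {m mΩ : MeasurableSpace Ω} [MeasurableSpace α]
    [MeasurableSpace β] {P : Measure Ω} [IsProbabilityMeasure P] (hm : m ≤ mΩ) {ξ : Ω → α}
    {η : Ω → β} (hξ : Measurable[m] ξ) (hη : Measurable η)
    (hind : Indep (MeasurableSpace.comap η inferInstance) m P) {h : α × β → ℝ≥0∞}
    (hh : Measurable h) :
    ∫⁻ ω, h (ξ ω, η ω) ∂P = ∫⁻ ω, ∫⁻ e, h (ξ ω, e) ∂(P.map η) ∂P := by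
  have hξ' : Measurable ξ := hξ.mono hm le_rfl
  have hi : IndepFun ξ η P := by
    rw [IndepFun_iff_Indep]
    exact indep_of_indep_of_le_left hind.symm hξ.comap_le
  have hmap := (indepFun_iff_map_prod_eq_prod_map_map hξ'.aemeasurable hη.aemeasurable).1 hi
  have : IsProbabilityMeasure (P.map η) := Measure.isProbabilityMeasure_map hη.aemeasurable
  have : IsProbabilityMeasure (P.map ξ) := Measure.isProbabilityMeasure_map hξ'.aemeasurable
  calc ∫⁻ ω, h (ξ ω, η ω) ∂P = ∫⁻ z, h z ∂(P.map fun ω => (ξ ω, η ω)) :=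
        (lintegral_map hh (hξ'.prodMk hη)).symm
    _ = ∫⁻ a, ∫⁻ e, h (a, e) ∂(P.map η) ∂(P.map ξ) := by
        rw [hmap, lintegral_prod _ hh.aemeasurable]
    _ = _ := lintegral_map hh.lintegral_prod_right' hξ'

namespace ASRModel

variable {Ω : Type*} [MeasurableSpace Ω] {M : ASRModel Ω} {P : Measure Ω}
  {ℱ : Filtration ℕ ‹MeasurableSpace Ω›}

theorem Assumptions.sigma_mul_sqrt_ne_zero (hM : M.Assumptions P ℱ) :
    M.sigma * Real.sqrt M.dt ≠ 0 :=
  mul_ne_zero hM.sigma_pos.ne' (Real.sqrt_pos.2 hM.dt_pos).ne'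

theorem Assumptions.measurable_redState (hM : M.Assumptions P ℱ) {v : ℕ → Ω → ℝ}
    (hv : ∀ k, Measurable[ℱ k] (v k)) (n : ℕ) (q S A : ℝ) {k : ℕ} (hk : k ≤ M.N) :
    Measurable[ℱ k] (M.redState n q S A v k) :=
  ASRModel.measurable_redState (m := ℱ k) hM.continuous_G.measurable
    (fun j hj => (hv j).mono (ℱ.mono hj.le) le_rfl)
    (fun j hj => (hM.eps_measurable (j + 1) (by lia) (by lia)).mono (ℱ.mono (by lia)) le_rfl)

theorem Assumptions.measurable_bookValue (hM : M.Assumptions P ℱ) {v : ℕ → Ω → ℝ}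
    (hv : ∀ k, Measurable[ℱ k] (v k)) (n : ℕ) (x q S A : ℝ) {k : ℕ} (hk : k ≤ M.N) :
    Measurable[ℱ k] (M.bookValue n x q S A v k) :=
  ASRModel.measurable_bookValue (m := ℱ k) hM.continuous_G.measurable
    hM.continuous_F.measurable hM.L_continuous.measurable
    (fun j hj => (hv j).mono (ℱ.mono hj.le) le_rfl)
    (fun j hj => (hM.eps_measurable (j + 1) (by lia) (by lia)).mono (ℱ.mono (by lia)) le_rfl)
    (fun j hj => (hM.epsX_measurable (j + 1) (by lia) (by lia)).mono (ℱ.mono (by lia)) le_rfl)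
    (fun j hj => (hM.V_measurable (j + 1) (by lia) (by lia)).mono (ℱ.mono (by lia)) le_rfl)

/-- The candidate for the optimal conditional disutility along a strategy. -/
noncomputable def potential (M : ASRModel Ω) (P : Measure Ω) (n : ℕ) (x q S A : ℝ)
    (v : ℕ → Ω → ℝ) (k : ℕ) (ω : Ω) : ℝ≥0∞ :=
  M.weight n x q S A v k ω * M.expTheta P k (M.redState n q S A v k ω)

variable {n k : ℕ} {x q S A c : ℝ} {v : ℕ → Ω → ℝ} {τ : Ω → ℕ}

theorem Assumptions.potential_succ (hM : M.Assumptions P ℱ) (hn : n ≠ 0) (hk : n ≤ k) {ω : Ω}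
    (hV : M.V (k + 1) ω = c) :
    M.potential P n x q S A v (k + 1) ω = M.weight n x q S A v k ω
      * M.stepFactor k c (M.expTheta P (k + 1)) (v k ω) (M.redState n q S A v k ω)
        (M.eps (k + 1) ω, M.epsX (k + 1) ω) := by
  have hs := hM.sigma_mul_sqrt_ne_zero
  rw [potential, weight, weight, stepFactor, redState_succ hs hn hk, bookValue_succ hs hn hk, hV,
    ← mul_assoc, ← ENNReal.ofReal_mul (Real.exp_nonneg _), ← Real.exp_add]
  congr 4
  ring

/-- The conditional expectation of the next potential given `ℱ k`, tested on events so that infinite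
values are allowed. -/
theorem Assumptions.setLIntegral_potential_succ [IsProbabilityMeasure P] (hM : M.Assumptions P ℱ)
    (hv : ∀ k, Measurable[ℱ k] (v k)) (hn : n ≠ 0) (hk : n ≤ k) (hkN : k < M.N)
    (hV : ∀ᵐ ω ∂P, M.V (k + 1) ω = c) {B : Set Ω} (hB : MeasurableSet[ℱ k] B) :
    ∫⁻ ω in B, M.potential P n x q S A v (k + 1) ω ∂P
      = ∫⁻ ω in B, M.weight n x q S A v k ω * M.stepCost k c (M.noiseLaw P (k + 1))
          (M.expTheta P (k + 1)) (v k ω) (M.redState n q S A v k ω) ∂P := by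
  have hW := (hM.isRegular_expTheta (k + 1)).lowerSemicontinuous.measurable
  have hsf := hM.measurable_stepFactor k c hW
  have hB' : MeasurableSet B := ℱ.le k _ hB
  -- The event `B` is absorbed into the weight, which stays `ℱ k`-measurable and can be frozen.
  let w : Ω → ℝ≥0∞ := B.indicator (M.weight n x q S A v k)
  have hwt : Measurable[ℱ k] (M.weight n x q S A v k) :=
    ((hM.measurable_bookValue hv n x q S A hkN.le).const_mul _).exp.ennreal_ofReal
  have hw : Measurable[ℱ k] w := hwt.indicator hB
  have hξ : Measurable[ℱ k] fun ω => (w ω, v k ω, M.redState n q S A v k ω) :=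
    hw.prodMk ((hv k).prodMk (hM.measurable_redState hv n q S A hkN.le))
  let h : (ℝ≥0∞ × ℝ × (ℝ × ℝ)) × (ℝ × ℝ) → ℝ≥0∞ := fun p =>
    p.1.1 * M.stepFactor k c (M.expTheta P (k + 1)) p.1.2.1 p.1.2.2 p.2
  have hh : Measurable h := by
    have h1 : Measurable fun p : (ℝ≥0∞ × ℝ × (ℝ × ℝ)) × (ℝ × ℝ) =>
        ((p.1.2.1, p.1.2.2, p.2) : ℝ × (ℝ × ℝ) × (ℝ × ℝ)) := by fun_prop
    have h2 := Measurable.comp hsf h1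
    have h3 : Measurable fun p : (ℝ≥0∞ × ℝ × (ℝ × ℝ)) × (ℝ × ℝ) => p.1.1 := by fun_prop
    exact h3.mul h2
  have key := lintegral_comp_of_indep (ℱ.le k) hξ (hM.measurable_noise (by lia) hkN)
    (hM.indep_past k hkN) hh
  rw [← lintegral_indicator hB', ← lintegral_indicator hB']
  refine Eq.trans (lintegral_congr_ae ?_) (key.trans (lintegral_congr fun ω => ?_))
  · filter_upwards [hV] with ω hω
    by_cases hωB : ω ∈ B
    · simp only [Set.indicator_of_mem hωB, h, w]
      exact hM.potential_succ hn hk hω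
    · simp only [Set.indicator_of_notMem hωB, h, w, zero_mul]
  · simp only [h]
    rw [lintegral_const_mul _ (hM.measurable_stepFactor_right k c hW _ _)]
    by_cases hωB : ω ∈ B
    · simp only [Set.indicator_of_mem hωB, w]
      rfl
    · simp only [Set.indicator_of_notMem hωB, w, zero_mul]

/-- The expected potential at the delivery date or at date `k`, whichever comes first. -/
noncomputable def stoppedValue (M : ASRModel Ω) (P : Measure Ω) (n : ℕ) (x q S A : ℝ)
    (v : ℕ → Ω → ℝ) (τ : Ω → ℕ) (k : ℕ) : ℝ≥0∞ :=
  ∫⁻ ω, M.potential P n x q S A v (min k (τ ω)) ω ∂P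

theorem measurableSet_lt_of_isStoppingTime
    (hτ : IsStoppingTime ℱ (fun ω => ((τ ω : ℕ) : WithTop ℕ))) (k : ℕ) :
    MeasurableSet[ℱ k] {ω | k < τ ω} := by
  have h : {ω | k < τ ω} = {ω | (k : WithTop ℕ) < ((τ ω : ℕ) : WithTop ℕ)} := by
    ext ω
    exact (Nat.cast_lt (α := WithTop ℕ)).symm
  rw [h]
  exact hτ.measurableSet_gt k

/-- Splitting on `{k < τ}` isolates a stopped part that is the same at dates `k` and `k + 1`. -/
theorem stoppedValue_eq (k : ℕ) (hB : MeasurableSet {ω | k < τ ω}) :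
    M.stoppedValue P n x q S A v τ k
      = ∫⁻ ω in {ω | k < τ ω}, M.potential P n x q S A v k ω ∂P
        + ∫⁻ ω in {ω | k < τ ω}ᶜ, M.potential P n x q S A v (τ ω) ω ∂P := by
  rw [stoppedValue, ← lintegral_add_compl _ hB]
  congr 1
  · refine setLIntegral_congr_fun hB fun ω hω => ?_
    have hω : k < τ ω := hω
    simp only [min_eq_left hω.le]
  · refine setLIntegral_congr_fun hB.compl fun ω hω => ?_
    have hω : τ ω ≤ k := not_lt.1 hω
    simp only [min_eq_right hω]

theorem stoppedValue_succ_eq (k : ℕ) (hB : MeasurableSet {ω | k < τ ω}) :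
    M.stoppedValue P n x q S A v τ (k + 1)
      = ∫⁻ ω in {ω | k < τ ω}, M.potential P n x q S A v (k + 1) ω ∂P
        + ∫⁻ ω in {ω | k < τ ω}ᶜ, M.potential P n x q S A v (τ ω) ω ∂P := by
  rw [stoppedValue, ← lintegral_add_compl _ hB]
  congr 1
  · refine setLIntegral_congr_fun hB fun ω hω => ?_
    have hω : k < τ ω := hω
    simp only [min_eq_left (Nat.succ_le_of_lt hω)]
  · refine setLIntegral_congr_fun hB.compl fun ω hω => ?_
    have hω : τ ω ≤ k := not_lt.1 hω
    simp only [min_eq_right (hω.trans (Nat.le_succ k))]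

theorem stoppedValue_start [IsProbabilityMeasure P] (hn : n ≠ 0) (hτ : ∀ ω, n ≤ τ ω) :
    M.stoppedValue P n x q S A v τ n
      = ENNReal.ofReal (Real.exp (-M.gamma * (M.Q * A - x - q * S + M.F q)))
        * M.expTheta P n (q, (S - A) / (M.sigma * Real.sqrt M.dt)) := by
  have : ∀ ω, M.potential P n x q S A v (min n (τ ω)) ω
      = ENNReal.ofReal (Real.exp (-M.gamma * (M.Q * A - x - q * S + M.F q)))
        * M.expTheta P n (q, (S - A) / (M.sigma * Real.sqrt M.dt)) := fun ω => by
    rw [min_eq_left (hτ ω), potential, weight, bookValue_self hn, redState_self hn]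
  simp only [stoppedValue, this, lintegral_const, measure_univ, mul_one]

theorem Assumptions.stoppedValue_le_succ [IsProbabilityMeasure P] (hM : M.Assumptions P ℱ)
    (hv : ∀ k, Measurable[ℱ k] (v k))
    (hτ : IsStoppingTime ℱ (fun ω => ((τ ω : ℕ) : WithTop ℕ)))
    (hn : n ≠ 0) (hk : n ≤ k) (hkN : k < M.N) :
    M.stoppedValue P n x q S A v τ k ≤ M.stoppedValue P n x q S A v τ (k + 1) := by
  obtain ⟨c, -, hV⟩ := hM.V_const (k + 1) (by lia) hkN
  have hB := measurableSet_lt_of_isStoppingTime hτ k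
  have hB' := ℱ.le k _ hB
  rw [stoppedValue_eq k hB', stoppedValue_succ_eq k hB',
    hM.setLIntegral_potential_succ hv hn hk hkN hV hB]
  gcongr with ω
  exact mul_le_mul' le_rfl ((hM.expTheta_le_iInf_stepCost hkN hV _).trans (iInf_le _ _))

/-- No strategy does better than the potential. -/
theorem Assumptions.le_cost [IsProbabilityMeasure P] (hM : M.Assumptions P ℱ)
    (hn : n ≠ 0) (hnN : n ≤ M.N) {s : (ℕ → Ω → ℝ) × (Ω → ℕ)} (hs : s ∈ M.strategies ℱ n) :
    ENNReal.ofReal (Real.exp (-M.gamma * (M.Q * A - x - q * S + M.F q)))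
        * M.expTheta P n (q, (S - A) / (M.sigma * Real.sqrt M.dt))
      ≤ ∫⁻ ω, ENNReal.ofReal (Real.exp (-M.gamma * M.wealth n x q S A s.1 (s.2 ω) ω)) ∂P := by
  obtain ⟨hv, hτ, hs⟩ := hs
  have hmono : ∀ k, n ≤ k → k ≤ M.N →
      M.stoppedValue P n x q S A s.1 s.2 n ≤ M.stoppedValue P n x q S A s.1 s.2 k := by
    intro k hk
    induction k, hk using Nat.le_induction with
    | base => exact fun _ => le_rfl
    | succ k hk ih => exact fun h =>
        (ih (by lia)).trans (hM.stoppedValue_le_succ hv hτ hn hk (by lia))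
  rw [← stoppedValue_start hn fun ω => (hs ω).2.1]
  refine (hmono M.N hnN le_rfl).trans (lintegral_mono fun ω => ?_)
  simp only [min_eq_right (hs ω).2.2]
  rw [exp_wealth_eq, potential]
  exact mul_le_mul' le_rfl (hM.expTheta_le_penalty (hs ω).1 _)

/-- A strategy attaining the infimum in the one-step problems before delivery, and delivering when
it is optimal to do so, is optimal. -/
theorem Assumptions.cost_eq [IsProbabilityMeasure P] (hM : M.Assumptions P ℱ)
    (hn : n ≠ 0) (hnN : n ≤ M.N) (hs : (v, τ) ∈ M.strategies ℱ n) {c : ℕ → ℝ}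
    (hV : ∀ k < M.N, ∀ᵐ ω ∂P, M.V (k + 1) ω = c k)
    (hopt : ∀ k, n ≤ k → k < M.N → ∀ ω, k < τ ω →
      M.expTheta P k (M.redState n q S A v k ω) = M.stepCost k (c k) (M.noiseLaw P (k + 1))
        (M.expTheta P (k + 1)) (v k ω) (M.redState n q S A v k ω))
    (hdeliver : ∀ ω, M.expTheta P (τ ω) (M.redState n q S A v (τ ω) ω) = ENNReal.ofReal
      (Real.exp (M.gamma * (M.pen (M.redState n q S A v (τ ω) ω).1 + M.F 0)))) :
    ∫⁻ ω, ENNReal.ofReal (Real.exp (-M.gamma * M.wealth n x q S A v (τ ω) ω)) ∂P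
      = ENNReal.ofReal (Real.exp (-M.gamma * (M.Q * A - x - q * S + M.F q)))
        * M.expTheta P n (q, (S - A) / (M.sigma * Real.sqrt M.dt)) := by
  obtain ⟨hv, hτ, hs⟩ := hs
  have hconst : ∀ k, n ≤ k → k ≤ M.N →
      M.stoppedValue P n x q S A v τ k = M.stoppedValue P n x q S A v τ n := by
    intro k hk
    induction k, hk using Nat.le_induction with
    | base => exact fun _ => rfl
    | succ k hk ih =>
      intro h
      rw [← ih (by lia)]
      have hB := measurableSet_lt_of_isStoppingTime hτ k
      have hB' := ℱ.le k _ hB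
      rw [stoppedValue_eq k hB', stoppedValue_succ_eq k hB',
        hM.setLIntegral_potential_succ hv hn hk h (hV k h) hB]
      congr 1
      refine setLIntegral_congr_fun hB' fun ω hω => ?_
      simp only [potential]
      rw [hopt k hk h ω hω]
  rw [← stoppedValue_start hn fun ω => (hs ω).2.1, ← hconst M.N hnN le_rfl]
  refine lintegral_congr fun ω => ?_
  rw [min_eq_right (hs ω).2.2, exp_wealth_eq, potential, hdeliver]

/-! ### Construction of an optimal strategy -/

/-- The reduced state, started at date `n` from `y₀` and driven by the feedback controls `w`,
`i` periods later. -/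
noncomputable def feedbackState (M : ASRModel Ω) (w : ℕ → ℝ × ℝ → ℝ) (n : ℕ) (y₀ : ℝ × ℝ) :
    ℕ → Ω → ℝ × ℝ
  | 0, _ => y₀
  | i + 1, ω => M.stepState (n + i) (w (n + i) (M.feedbackState w n y₀ i ω))
      (M.feedbackState w n y₀ i ω) (M.eps (n + i + 1) ω, M.epsX (n + i + 1) ω)

theorem Assumptions.measurable_feedbackState (hM : M.Assumptions P ℱ) {w : ℕ → ℝ × ℝ → ℝ}
    (hw : ∀ k, Measurable (w k)) (y₀ : ℝ × ℝ) (i : ℕ) (hi : n + i ≤ M.N) :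
    Measurable[ℱ (n + i)] (M.feedbackState w n y₀ i) := by
  induction i with
  | zero => exact measurable_const
  | succ i ih =>
    have h0 : Measurable[ℱ (n + (i + 1))] (M.feedbackState w n y₀ i) :=
      (ih (by lia)).mono (ℱ.mono (by lia)) le_rfl
    have h1 : Measurable[ℱ (n + (i + 1))]
        fun ω => (M.eps (n + i + 1) ω, M.epsX (n + i + 1) ω) :=
      (hM.eps_measurable (n + i + 1) (by lia) hi).prodMk
        (hM.epsX_measurable (n + i + 1) (by lia) hi)
    have h2 : Measurable[ℱ (n + (i + 1))] fun ω => w (n + i) (M.feedbackState w n y₀ i ω) :=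
      Measurable.comp (hw (n + i)) h0
    have h3 := (hM.continuous_stepState (n + i)).measurable
    exact Measurable.comp h3 (h2.prodMk (h0.prodMk h1))

open scoped Classical in
theorem Assumptions.exists_cost_eq [IsProbabilityMeasure P] (hM : M.Assumptions P ℱ)
    (hn : n ≠ 0) (hnN : n ≤ M.N) (x q S A : ℝ) : ∃ s ∈ M.strategies ℱ n,
    ∫⁻ ω, ENNReal.ofReal (Real.exp (-M.gamma * M.wealth n x q S A s.1 (s.2 ω) ω)) ∂P
      = ENNReal.ofReal (Real.exp (-M.gamma * (M.Q * A - x - q * S + M.F q)))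
        * M.expTheta P n (q, (S - A) / (M.sigma * Real.sqrt M.dt)) := by
  have hWm : ∀ k, Measurable (M.expTheta P k) := fun k =>
    (hM.isRegular_expTheta k).lowerSemicontinuous.measurable
  have hex : ∀ k, ∃ (c : ℝ) (w : ℝ × ℝ → ℝ), Measurable w ∧ (k < M.N →
      (∀ᵐ ω ∂P, M.V (k + 1) ω = c) ∧ ∀ y,
        M.stepCost k c (M.noiseLaw P (k + 1)) (M.expTheta P (k + 1)) (w y) y
          = ⨅ u, M.stepCost k c (M.noiseLaw P (k + 1)) (M.expTheta P (k + 1)) u y) := by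
    intro k
    by_cases hk : k < M.N
    · obtain ⟨c, hc, hV⟩ := hM.V_const (k + 1) (by lia) hk
      have := hM.isProbabilityMeasure_noiseLaw (k := k + 1) (by lia) hk
      have hreg := hM.isRegular_expTheta (k + 1)
      obtain ⟨w, hw, hmin⟩ := (hM.locallyCoercive_stepCost k hc (M.noiseLaw P (k + 1))
        hreg).exists_measurable_argmin
          (hM.lowerSemicontinuous_stepCost k c _ hreg.lowerSemicontinuous)
      exact ⟨c, w, hw, fun _ => ⟨hV, hmin⟩⟩
    · exact ⟨0, fun _ => 0, measurable_const, fun h => absurd h hk⟩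
  choose c w hw hcw using hex
  set y₀ : ℝ × ℝ := (q, (S - A) / (M.sigma * Real.sqrt M.dt)) with hy₀
  -- The state is built from the feedback maps first, because `redState` already presupposes the
  -- control; `hred` then identifies the two. For `k < n` truncated subtraction gives the constant
  -- `y₀`.
  let Y : ℕ → Ω → ℝ × ℝ := fun k => M.feedbackState w n y₀ (k - n)
  have hY : ∀ k, k ≤ M.N → Measurable[ℱ k] (Y k) := by
    intro k hk
    rcases le_total n k with h | h
    · have := hM.measurable_feedbackState (n := n) hw y₀ (k - n) (by lia)
      rwa [Nat.add_sub_cancel' h] at this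
    · simp only [Y, Nat.sub_eq_zero_of_le h]
      exact measurable_const
  -- The noises are known to be adapted only up to date `N`, hence the cut-off.
  let v : ℕ → Ω → ℝ := fun k ω => if k < M.N then w k (Y k ω) else 0
  have hv : ∀ k, Measurable[ℱ k] (v k) := by
    intro k
    by_cases hk : k < M.N
    · simp only [v, hk, if_true]
      exact Measurable.comp (hw k) (hY k hk.le)
    · simp only [v, hk, if_false]
      exact measurable_const
  have hred : ∀ k, n ≤ k → k ≤ M.N → ∀ ω, M.redState n q S A v k ω = Y k ω := by
    intro k hk
    induction k, hk using Nat.le_induction with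
    | base => intro _ ω; rw [redState_self hn]; simp [Y, feedbackState, hy₀]
    | succ k hk ih =>
      intro h ω
      obtain ⟨i, rfl⟩ := Nat.exists_eq_add_of_le hk
      have h' : n + i < M.N := h
      have e1 : n + i + 1 - n = i + 1 := by lia
      rw [redState_succ hM.sigma_mul_sqrt_ne_zero hn hk, ih h'.le]
      simp only [v, h', if_true, Y, e1, Nat.add_sub_cancel_left, feedbackState]
  -- Dates at which delivery is optimal. Date `N` always qualifies, so the first such date exists.
  let D : ℕ → Set Ω := fun k => {ω | n ≤ k ∧ (k = M.N ∨ (k < M.N ∧ k ∈ M.dates ∧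
    M.expTheta P k (Y k ω)
      = ENNReal.ofReal (Real.exp (M.gamma * (M.pen (Y k ω).1 + M.F 0)))))}
  have hD : ∀ k, MeasurableSet[ℱ k] (D k) := by
    intro k
    refine (MeasurableSet.const _).inter ((MeasurableSet.const _).union ?_)
    by_cases hk : k < M.N
    · refine (MeasurableSet.const _).inter ((MeasurableSet.const _).inter ?_)
      have hp : Measurable fun y : ℝ × ℝ =>
          ENNReal.ofReal (Real.exp (M.gamma * (M.pen y.1 + M.F 0))) :=
        hM.isRegular_penalty.lowerSemicontinuous.measurable
      exact (hY k hk.le) (measurableSet_eq_fun (hWm k) hp)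
    · simp only [hk, false_and]
      exact MeasurableSet.const _
  let τ : Ω → ℕ := fun ω => sInf {k | ω ∈ D k}
  have hDN : ∀ ω, ω ∈ D M.N := fun ω => ⟨hnN, Or.inl rfl⟩
  have hτD : ∀ ω, ω ∈ D (τ ω) := fun ω => Nat.sInf_mem (s := {k | ω ∈ D k}) ⟨M.N, hDN ω⟩
  have hτN : ∀ ω, τ ω ≤ M.N := fun ω => Nat.sInf_le (hDN ω)
  have hτs : IsStoppingTime ℱ (fun ω => ((τ ω : ℕ) : WithTop ℕ)) := by
    intro k
    have : {ω | (fun ω => ((τ ω : ℕ) : WithTop ℕ)) ω ≤ WithTop.some k}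
        = ⋃ j ∈ Set.Iic k, D j := by
      ext ω
      simp only [Set.mem_iUnion, Set.mem_Iic, exists_prop]
      refine (Nat.cast_le (α := WithTop ℕ)).trans ?_
      exact ⟨fun h => ⟨τ ω, h, hτD ω⟩, fun ⟨j, hj, hjD⟩ => (Nat.sInf_le hjD).trans hj⟩
    rw [this]
    exact MeasurableSet.biUnion (Set.to_countable _) fun j hj => ℱ.mono hj _ (hD j)
  have hs : (v, τ) ∈ M.strategies ℱ n := by
    refine ⟨hv, hτs, fun ω => ⟨?_, (hτD ω).1, hτN ω⟩⟩
    rcases (hτD ω).2 with h | h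
    · exact Or.inr h
    · exact Or.inl h.2.1
  refine ⟨(v, τ), hs, hM.cost_eq hn hnN hs (fun k hk => (hcw k hk).1) ?_ ?_⟩
  · intro k hk hkN ω hω
    obtain ⟨hV, hmin⟩ := hcw k hkN
    rw [hred k hk hkN.le]
    have hvk : v k ω = w k (Y k ω) := if_pos hkN
    refine Eq.trans ?_ ((hmin (Y k ω)).symm.trans (by rw [← hvk]))
    by_cases hd : k ∈ M.dates
    · rw [hM.expTheta_of_mem hkN hV hd (hWm _)]
      -- If the penalty were at most the continuation cost, `k` would be a date of optimal delivery,
      -- contradicting `k < τ ω`.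
      refine min_eq_left (le_of_not_ge fun hle => ?_)
      refine Nat.notMem_of_lt_sInf hω ⟨hk, Or.inr ⟨hkN, hd, ?_⟩⟩
      rw [hM.expTheta_of_mem hkN hV hd (hWm _)]
      exact min_eq_right hle
    · rw [hM.expTheta_of_notMem hkN hV hd (hWm _)]
  · intro ω
    rw [hred (τ ω) (hτD ω).1 (hτN ω)]
    rcases (hτD ω).2 with h | h
    · rw [expTheta_terminal h.ge]
    · exact h.2.2

/-! ### Conclusion in the extended reals -/

theorem exp_neg_gamma_mul_coe_sub {γ : ℝ} (hγ : 0 < γ) (r : ℝ) {x : EReal} (hx : x ≠ ⊥) :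
    EReal.exp (((-γ : ℝ) : EReal) * ((r : EReal) - x))
      = ENNReal.ofReal (Real.exp (-γ * r)) * EReal.exp ((γ : EReal) * x) := by
  have h : ((-γ : ℝ) : EReal) * ((r : EReal) - x)
      = (γ : EReal) * (((-r : ℝ) : EReal) + x) := by
    induction x with
    | bot => exact absurd rfl hx
    | coe t => norm_cast; ring
    | top =>
      rw [EReal.sub_top, EReal.coe_mul_bot_of_neg (by linarith), EReal.coe_add_top,
        EReal.coe_mul_top_of_pos hγ]
  rw [h, exp_gamma_mul_coe_add hγ]
  congr 3; ring

end ASRModel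

theorem mainTheorem2 {Ω : Type*} [mΩ : MeasurableSpace Ω] (P : Measure Ω) [IsProbabilityMeasure P]
    (ℱ : Filtration ℕ mΩ) (M : ASRModel Ω) (hM : M.Assumptions P ℱ) :
    (∀ n, 1 ≤ n → n ≤ M.N → ∀ x q S A : ℝ,
      M.u P ℱ n x q S A =
        -((EReal.exp (((-M.gamma : ℝ) : EReal) *
            (((M.Q * A - x - q * S + M.F q : ℝ) : EReal)
              - M.theta P n q ((S - A) / (M.sigma * Real.sqrt M.dt)))) : ℝ≥0∞) : EReal)) ∧
    (∀ n, 1 ≤ n → n ≤ M.N → ∀ q Z : ℝ, M.theta P n q Z ≠ ⊥) ∧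
    ((∀ a b : ℝ, Integrable (fun ω => Real.exp (a * M.eps 1 ω + b * M.epsX 1 ω)) P) →
      ∀ n, 1 ≤ n → n ≤ M.N → ∀ q Z : ℝ, M.theta P n q Z ≠ ⊤) := by
  refine ⟨fun n hn hnN x q S A => ?_, fun n _ _ q Z => hM.theta_ne_bot n q Z,
    fun hexp n _ _ q Z => hM.theta_ne_top hexp n q Z⟩
  rw [ASRModel.exp_neg_gamma_mul_coe_sub hM.gamma_pos _ (hM.theta_ne_bot n _ _)]
  have hn0 : n ≠ 0 := by lia
  refine le_antisymm (iSup₂_le fun s hs => ?_) ?_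
  · rw [EReal.neg_le_neg_iff]
    exact EReal.coe_ennreal_le_coe_ennreal_iff.2 (hM.le_cost hn0 hnN hs)
  · obtain ⟨s, hs, hcost⟩ := hM.exists_cost_eq hn0 hnN x q S A
    refine le_trans (le_of_eq ?_) (le_iSup₂ (f := fun s _ => _) s hs)
    rw [hcost]
    rfl
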